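/- Let $R$ be a principal ideal domain of characteristic zero with fraction field $K$, and let $L$ be an $R$-Lie lattice, that is, a Lie algebra over $R$ that is free of finite rank as an $R$-module. Let $N$ be the nilpotent radical of $L$ (its largest nilpotent ideal), $r$ its rank and $c$ its nilpotency class. Suppose that $L$ is splittable, that is, there is a Lie subalgebra $S\le L$ with $L=N\rtimes S$ (so $L=N\oplus S$ as $R$-modules). For $m\ge 1$ put $N_m=N\cap[N_K,\dots,N_K]$ ($m$ factors, $N_K=N\otimes_R K$). Call a basis $(x_1,\dots,x_r)$ of the $R$-module $N$ adapted if each $N_m$ is spanned over $R$ by an initial segment $x_1,\dots,x_k$ of it. For such a basis let $\omega(x_i)=\max\{m\mid x_i\in N_m\}$. In the universal enveloping algebra $U=\mathcal U_R(N)$ put $\omega(x_1^{\alpha_1}\cdots x_r^{\alpha_r})=\sum_i\alpha_i\omega(x_i)$, let $\omega$ of a linear combination of distinct ordered monomials be the minimum of $\omega$ over the monomials with nonzero coefficient, and let $\omega(0)=\infty$. Put $U^c=\{u\in U\mid\omega(u)>c\}$. Then $N$ is nilpotent, adapted bases exist, and for every adapted basis the $R$-module $U/U^c$ is free of finite rank.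 If $r\ge 1$, then $$\operatorname{rk}_R(U/U^c)\le\eta\,\frac{2^r}{\sqrt r},\qquad \eta=\sqrt{\frac2\pi}\prod_{l=1}^\infty\frac{2^l}{2^l-1}\approx 2.763 .$$ Moreover, for every Lie subalgebra $S$ with $L=N\rtimes S$ there is a representation of $R$-Lie algebras $$\Phi\colon L\to\operatorname{End}_R(U/U^c)$$ (whose degree is $\operatorname{rk}_R(U/U^c)$) that is injective on $N$ and such that - $\Phi(n)$ is induced by the left multiplication $u\mapsto nu$ of $U$, for every $n\in N$; - $\Phi(s)$ is induced by the derivation of $U$ that extends $\operatorname{ad}_s|_N$, for every $s\in S$. -/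

import Mathlib

open scoped TensorProduct

attribute [local instance 100] LieRing.ofAssociativeRing

namespace LieLattice

noncomputable section

universe u v

/-- The nilpotent radical of `L`: the sum of all ideals of `L` that are nilpotent as Lie algebras.
For a Lie lattice it is the largest nilpotent ideal. (It differs from Mathlib's
`LieAlgebra.maxNilpotentIdeal`, the sum of the ideals that are nilpotent as `L`-modules.) -/
def nilpotentRadical (R : Type u) (L : Type v) [CommRing R] [LieRing L] [LieAlgebra R L] :
    LieIdeal R L :=
  sSup {I : LieIdeal R L | LieRing.IsNilpotent I}

/-- The subalgebra `S` is a complement of the nilpotent radical `N`, that is, `L = N ⋊ S`. -/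
def IsSplitting (R : Type u) (L : Type v) [CommRing R] [LieRing L] [LieAlgebra R L]
    (S : LieSubalgebra R L) : Prop :=
  IsCompl (nilpotentRadical R L).toSubmodule S.toSubmodule

/-- `L` is splittable: `L` is the semidirect product of its nilpotent radical and a subalgebra. -/
def IsSplittable (R : Type u) (L : Type v) [CommRing R] [LieRing L] [LieAlgebra R L] : Prop :=
  ∃ S : LieSubalgebra R L, IsSplitting R L S

/-- The nilpotency class of a nilpotent Lie algebra `M`: the least `k` such that all iterated
brackets of `k + 1` elements vanish. -/
abbrev nilpotencyClass (M : Type v) [LieRing M] : ℕ :=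
  LieModule.nilpotencyLength M M

section Weight

variable (R : Type u) [CommRing R] [IsDomain R]
variable (M : Type v) [LieRing M] [LieAlgebra R M]

/-- `M_m = [M_K, …, M_K] ∩ M` with `m ≥ 1` factors, `K` the fraction field of `R` and
`M_K = K ⊗ M`. Mathlib's lower central series starts at `0`, hence the shift;
`M_0` is `M_1 = M`. -/
def isolatedSeries (m : ℕ) : Submodule R M :=
  Submodule.comap (TensorProduct.mk R (FractionRing R) M 1)
    ((LieModule.lowerCentralSeries (FractionRing R) (FractionRing R ⊗[R] M)
      (FractionRing R ⊗[R] M) (m - 1)).toSubmodule.restrictScalars R)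

variable {R M}

/-- The basis `b` is adapted to the series `M = M_1 ⊇ M_2 ⊇ …`: each `M_m` is spanned by an
initial segment of `b`. -/
def IsAdapted {r : ℕ} (b : Module.Basis (Fin r) R M) : Prop :=
  ∀ m : ℕ, 1 ≤ m → ∃ k : ℕ, Submodule.span R (b '' {i | (i : ℕ) < k}) = isolatedSeries R M m

/-- `ω(x) = max {m | x ∈ M_m}` for `x` in `M` (used for basis elements). -/
def elementWeight (R : Type u) [CommRing R] [IsDomain R] {M : Type v} [LieRing M]
    [LieAlgebra R M] (x : M) : ℕ :=
  sSup {m : ℕ | x ∈ isolatedSeries R M m}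

/-- The ordered monomial `x_1 ^ α_1 ⋯ x_r ^ α_r` in the enveloping algebra. -/
def monomial {r : ℕ} (b : Module.Basis (Fin r) R M) (α : Fin r → ℕ) :
    UniversalEnvelopingAlgebra R M :=
  (List.ofFn fun i => UniversalEnvelopingAlgebra.ι R (b i) ^ α i).prod

/-- `ω(x^α) = ∑ i, α_i ω(x_i)`. -/
def monomialWeight {r : ℕ} (b : Module.Basis (Fin r) R M) (α : Fin r → ℕ) : ℕ :=
  ∑ i, α i * elementWeight R (b i)

/-- `ω(∑ c_α x^α) = min {ω(x^α) | c_α ≠ 0}`, with `ω(0) = ∞`. The expansion of an element in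
ordered monomials exists and is unique (Poincaré-Birkhoff-Witt), so that the supremum is taken over
one `c` only. -/
def weight {r : ℕ} (b : Module.Basis (Fin r) R M) (u : UniversalEnvelopingAlgebra R M) : ℕ∞ :=
  ⨆ (c : (Fin r → ℕ) →₀ R) (_ : Finsupp.linearCombination R (monomial b) c = u),
    ⨅ α ∈ c.support, (monomialWeight b α : ℕ∞)

theorem lt_weight_iff {r : ℕ} (b : Module.Basis (Fin r) R M) (m : ℕ)
    (u : UniversalEnvelopingAlgebra R M) :
    (m : ℕ∞) < weight b u ↔ ∃ c : (Fin r → ℕ) →₀ R,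
      Finsupp.linearCombination R (monomial b) c = u ∧
        ∀ α ∈ c.support, m < monomialWeight b α := by
  simp only [weight, lt_iSup_iff]
  constructor
  · rintro ⟨c, hc, h⟩
    refine ⟨c, hc, fun α hα => ?_⟩
    exact_mod_cast h.trans_le (iInf₂_le α hα)
  · rintro ⟨c, hc, h⟩
    refine ⟨c, hc, ?_⟩
    have h1 : ((m + 1 : ℕ) : ℕ∞) ≤ ⨅ α ∈ c.support, (monomialWeight b α : ℕ∞) :=
      le_iInf₂ fun α hα => by exact_mod_cast h α hα
    exact lt_of_lt_of_le (by exact_mod_cast Nat.lt_succ_self m) h1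

/-- `U^m = {u | ω(u) > m}`. -/
def weightSubmodule {r : ℕ} (b : Module.Basis (Fin r) R M) (m : ℕ) :
    Submodule R (UniversalEnvelopingAlgebra R M) where
  carrier := {u | (m : ℕ∞) < weight b u}
  zero_mem' := (lt_weight_iff b m 0).2 ⟨0, by simp, by simp⟩
  add_mem' := by
    classical
    intro u v hu hv
    obtain ⟨c, hc, hc'⟩ := (lt_weight_iff b m u).1 hu
    obtain ⟨d, hd, hd'⟩ := (lt_weight_iff b m v).1 hv
    refine (lt_weight_iff b m _).2 ⟨c + d, by rw [map_add, hc, hd], fun α hα => ?_⟩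
    rcases Finset.mem_union.1 (Finsupp.support_add hα) with h | h
    · exact hc' α h
    · exact hd' α h
  smul_mem' := by
    intro t u hu
    obtain ⟨c, hc, hc'⟩ := (lt_weight_iff b m u).1 hu
    exact (lt_weight_iff b m _).2
      ⟨t • c, by rw [map_smul, hc], fun α hα => hc' α (Finsupp.support_smul hα)⟩

/-- The quotient module `U / U^m`. -/
abbrev truncation {r : ℕ} (b : Module.Basis (Fin r) R M) (m : ℕ) : Type (max u v) :=
  UniversalEnvelopingAlgebra R M ⧸ weightSubmodule b m

/-- `E` is the extension `D^*` of `D` to a derivation of the (noncommutative) enveloping algebra.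
Since `M` generates the enveloping algebra, there is at most one such `E`. -/
def IsDerivationExtension (D : M →ₗ[R] M)
    (E : UniversalEnvelopingAlgebra R M →ₗ[R] UniversalEnvelopingAlgebra R M) : Prop :=
  (∀ u v, E (u * v) = E u * v + u * E v) ∧
    ∀ x : M, E (UniversalEnvelopingAlgebra.ι R x) = UniversalEnvelopingAlgebra.ι R (D x)

end Weight

/-- The universal enveloping algebra of the nilpotent radical of `L`. -/
abbrev radicalEnveloping (R : Type u) (L : Type v) [CommRing R] [LieRing L] [LieAlgebra R L] :
    Type (max u v) :=
  UniversalEnvelopingAlgebra R (nilpotentRadical R L)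

/-- `η = √(2/π) ∏_{l ≥ 1} 2^l / (2^l - 1)`, approximately `2.763`. -/
def eta : ℝ :=
  Real.sqrt (2 / Real.pi) * ∏' l : ℕ, (2 : ℝ) ^ (l + 1) / ((2 : ℝ) ^ (l + 1) - 1)

end

end LieLattice

/-! The action. Adapted bases satisfy `[N_m, N_n] ⊆ N_{m+n}`, so exchanging two neighbouring letters
of a word costs only shorter words of at least the same weight. Hence `U^c` is the span of all words
of weight above `c`, sorted or not. In this form it is visibly stable under left multiplications
`L_n` and, as derivations of `N` preserve every `N_m`, under the derivations `D_s` extending `ad s`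
(`ι_mul_mem_weightFiltration`, `derivation_mem_weightFiltration`). The relation `D_s L_n - L_n D_s =
L_{[s,n]}` is the bracket of `N ⋊ S`, so `L` acts on `U / U^c`. The action is injective on `N`
because `n · 1 = n` and no basis element has weight above `c`.

Freeness. Sorting shows that ordered monomials span `U`. For their independence, put the last basis
element `x` aside: the others span an ideal `I`, and `I ⊕ R x` acts on the polynomials `U(I)[t]`,
with `x` acting as `ad x + t`. Applied to `1`, monomials become monomials of `U(I)` times powers of
`t`, and induction on the rank applies (`linearIndependent_monomial`). So `U / U^c` has the
monomials of weight at most `c` as a basis.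

The rank. If `N_m = N_{m+1}` with `1 ≤ m ≤ c`, the series would be constant from `m` on; so all
weights `1, …, c` occur. Write `c = k + 1` and `r = k + d`. Replacing superfluous weights by `1`
only adds exponents, so the rank is at most the coefficient of `X^(k+1)` in `∏_{l=2}^{k+1} 1/(1 -
X^l) · 1/(1 - X)^(d+1)`. Scale the coefficient of `X^n` by `2^(-n)`. Those of the second factor are
at most `C(2d,d)/2^d`, and those of the first sum to at most `∏ 2^l/(2^l - 1)`. Wallis' product
gives `C(2d,d)/4^d ≤ √(2/π)/√(2d + 1/2)`, which suffices if `k ≤ d`. If `k > d`, the degree `k + 1`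
lies beyond the peak of the binomial factor, which saves the missing factor `θ` (`exists_coeff_le`).
-/

namespace LieLattice

noncomputable section

universe u v

/-! ### Extending derivations to the enveloping algebra -/

section Derivation

variable {R : Type u} [CommRing R] {M : Type v} [LieRing M] [LieAlgebra R M]

/-- The homomorphism `u ↦ u + ε E u` to the ring of dual numbers over the enveloping algebra, where
`E` is the extension of the derivation `D`. -/
def dualNumberLift (D : M →ₗ[R] M) (hD : ∀ x y, D ⁅x, y⁆ = ⁅D x, y⁆ + ⁅x, D y⁆) :
    UniversalEnvelopingAlgebra R M →ₐ[R]
      TrivSqZeroExt (UniversalEnvelopingAlgebra R M) (UniversalEnvelopingAlgebra R M) :=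
  UniversalEnvelopingAlgebra.lift R
    { toFun := fun x => TrivSqZeroExt.inl (UniversalEnvelopingAlgebra.ι R x) +
        TrivSqZeroExt.inr (UniversalEnvelopingAlgebra.ι R (D x))
      map_add' := fun x y => by ext <;> simp
      map_smul' := fun t x => by ext <;> simp
      map_lie' := fun {x y} => by
        ext
        · simp [LieRing.of_associative_ring_bracket]
        · simp [LieRing.of_associative_ring_bracket, hD, -UniversalEnvelopingAlgebra.ι_apply]
          abel }

theorem fst_dualNumberLift (D : M →ₗ[R] M) (hD : ∀ x y, D ⁅x, y⁆ = ⁅D x, y⁆ + ⁅x, D y⁆)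
    (u : UniversalEnvelopingAlgebra R M) : (dualNumberLift D hD u).fst = u := by
  have h : (TrivSqZeroExt.fstHom R (UniversalEnvelopingAlgebra R M)
      (UniversalEnvelopingAlgebra R M)).comp (dualNumberLift D hD) =
      AlgHom.id R (UniversalEnvelopingAlgebra R M) := by
    ext x
    simp only [dualNumberLift, LieHom.comp_apply, AlgHom.coe_toLieHom, AlgHom.comp_apply,
      UniversalEnvelopingAlgebra.lift_ι_apply, AlgHom.id_apply]
    simp
  exact DFunLike.congr_fun h u

/-- The extension of a derivation of `M` to the enveloping algebra. -/
def derivationExtension (D : M →ₗ[R] M) (hD : ∀ x y, D ⁅x, y⁆ = ⁅D x, y⁆ + ⁅x, D y⁆) :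
    UniversalEnvelopingAlgebra R M →ₗ[R] UniversalEnvelopingAlgebra R M where
  toFun u := (dualNumberLift D hD u).snd
  map_add' u v := by rw [map_add, TrivSqZeroExt.snd_add]
  map_smul' t u := by rw [map_smul, TrivSqZeroExt.snd_smul, RingHom.id_apply]

theorem derivationExtension_ι (D : M →ₗ[R] M) (hD : ∀ x y, D ⁅x, y⁆ = ⁅D x, y⁆ + ⁅x, D y⁆)
    (x : M) : derivationExtension D hD (UniversalEnvelopingAlgebra.ι R x) =
      UniversalEnvelopingAlgebra.ι R (D x) := by
  change (dualNumberLift D hD _).snd = _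
  rw [dualNumberLift, UniversalEnvelopingAlgebra.lift_ι_apply]
  change (TrivSqZeroExt.inl (UniversalEnvelopingAlgebra.ι R x) +
    TrivSqZeroExt.inr (UniversalEnvelopingAlgebra.ι R (D x)) : TrivSqZeroExt
      (UniversalEnvelopingAlgebra R M) (UniversalEnvelopingAlgebra R M)).snd = _
  rw [TrivSqZeroExt.snd_add, TrivSqZeroExt.snd_inl, TrivSqZeroExt.snd_inr, zero_add]

theorem derivationExtension_mul (D : M →ₗ[R] M) (hD : ∀ x y, D ⁅x, y⁆ = ⁅D x, y⁆ + ⁅x, D y⁆)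
    (u v : UniversalEnvelopingAlgebra R M) : derivationExtension D hD (u * v) =
      derivationExtension D hD u * v + u * derivationExtension D hD v := by
  change (dualNumberLift D hD _).snd = (dualNumberLift D hD _).snd * _ +
    _ * (dualNumberLift D hD _).snd
  rw [map_mul, TrivSqZeroExt.snd_mul, fst_dualNumberLift, fst_dualNumberLift]
  simp only [smul_eq_mul, MulOpposite.smul_eq_mul_unop, MulOpposite.unop_op, add_comm]

theorem derivationExtension_one (D : M →ₗ[R] M) (hD : ∀ x y, D ⁅x, y⁆ = ⁅D x, y⁆ + ⁅x, D y⁆) :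
    derivationExtension D hD 1 = 0 := by
  have := derivationExtension_mul D hD 1 1
  simpa using this

/-- The elements whose left multiplication preserves the span in question form a subalgebra
containing `M`; by the universal property it is everything. -/
theorem enveloping_induction {p : UniversalEnvelopingAlgebra R M → Prop}
    (one : p 1) (ι_mul : ∀ x u, p u → p (UniversalEnvelopingAlgebra.ι R x * u))
    (add : ∀ u v, p u → p v → p (u + v)) (smul : ∀ (t : R) u, p u → p (t • u))
    (u : UniversalEnvelopingAlgebra R M) : p u := by
  let P : Submodule R (UniversalEnvelopingAlgebra R M) :=
    { carrier := {u | p u}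
      zero_mem' := by simpa using smul 0 1 one
      add_mem' := fun {u v} hu hv => add u v hu hv
      smul_mem' := fun t u hu => smul t u hu }
  let A : Subalgebra R (UniversalEnvelopingAlgebra R M) :=
    { carrier := {a | ∀ u ∈ P, a * u ∈ P}
      mul_mem' := fun {a b} ha hb u hu => by rw [mul_assoc]; exact ha _ (hb _ hu)
      add_mem' := fun {a b} ha hb u hu => by rw [add_mul]; exact P.add_mem (ha _ hu) (hb _ hu)
      algebraMap_mem' := fun t u hu => by rw [← Algebra.smul_def]; exact P.smul_mem t hu }
  let f : M →ₗ⁅R⁆ A :=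
    { toFun := fun x => ⟨UniversalEnvelopingAlgebra.ι R x, fun u hu => ι_mul x u hu⟩
      map_add' := fun x y => by ext; simp
      map_smul' := fun t x => by ext; simp
      map_lie' := fun {x y} => by ext; simp [LieRing.of_associative_ring_bracket] }
  have h : A.val.comp (UniversalEnvelopingAlgebra.lift R f) =
      AlgHom.id R (UniversalEnvelopingAlgebra R M) := by
    ext x
    simp only [LieHom.comp_apply, AlgHom.coe_toLieHom, AlgHom.comp_apply,
      UniversalEnvelopingAlgebra.lift_ι_apply, AlgHom.id_apply]
    rfl
  have hu : u ∈ A := by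
    rw [← AlgHom.id_apply (R := R) u, ← h]
    exact (UniversalEnvelopingAlgebra.lift R f u).2
  simpa [P] using hu 1 one

theorem derivation_enveloping_ext
    {E F : UniversalEnvelopingAlgebra R M →ₗ[R] UniversalEnvelopingAlgebra R M}
    (hE : ∀ u v, E (u * v) = E u * v + u * E v) (hF : ∀ u v, F (u * v) = F u * v + u * F v)
    (h : ∀ x, E (UniversalEnvelopingAlgebra.ι R x) = F (UniversalEnvelopingAlgebra.ι R x)) :
    E = F := by
  ext u
  induction u using enveloping_induction with
  | one =>
    have h1 : E 1 = 0 := by simpa using hE 1 1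
    have h2 : F 1 = 0 := by simpa using hF 1 1
    rw [h1, h2]
  | ι_mul x u hu => rw [hE, hF, hu, h]
  | add u v hu hv => rw [map_add, map_add, hu, hv]
  | smul t u hu => rw [map_smul, map_smul, hu]

end Derivation

/-! ### The module `U(I)[t]` over an extension of `I` by one element -/

section Extension

variable {R : Type u} [CommRing R] {M : Type v} [LieRing M] [LieAlgebra R M]
variable {I : LieIdeal R M}

/-- Left multiplication on the coefficients of the `U(I)`-polynomials in one variable. -/
def coeffMul (I : LieIdeal R M) : UniversalEnvelopingAlgebra R I →ₐ[R]
    Module.End R (ℕ →₀ UniversalEnvelopingAlgebra R I) :=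
  AlgHom.ofLinearMap
    { toFun := fun u => Finsupp.mapRange.linearMap (LinearMap.mulLeft R u)
      map_add' := fun u v => by
        ext k w : 2
        simp only [LinearMap.comp_apply, LinearMap.add_apply, Finsupp.lsingle_apply,
          Finsupp.mapRange.linearMap_apply, Finsupp.mapRange_single, LinearMap.mulLeft_apply,
          add_mul, Finsupp.single_add]
      map_smul' := fun t u => by
        ext k w : 2
        simp only [LinearMap.comp_apply, LinearMap.smul_apply, Finsupp.lsingle_apply,
          Finsupp.mapRange.linearMap_apply, Finsupp.mapRange_single, LinearMap.mulLeft_apply,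
          smul_mul_assoc, Finsupp.smul_single, RingHom.id_apply] }
    (by
      ext k w : 2
      change Finsupp.mapRange.linearMap (LinearMap.mulLeft R 1) (Finsupp.single k w) =
        Finsupp.single k w
      simp only [Finsupp.mapRange.linearMap_apply, Finsupp.mapRange_single,
        LinearMap.mulLeft_apply, one_mul])
    (fun u v => by
      ext k w : 2
      change Finsupp.mapRange.linearMap (LinearMap.mulLeft R (u * v)) (Finsupp.single k w) =
        Finsupp.mapRange.linearMap (LinearMap.mulLeft R u)
          (Finsupp.mapRange.linearMap (LinearMap.mulLeft R v) (Finsupp.single k w))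
      simp only [Finsupp.mapRange.linearMap_apply, Finsupp.mapRange_single,
        LinearMap.mulLeft_apply, mul_assoc])

@[simp]
theorem coeffMul_single (u v : UniversalEnvelopingAlgebra R I) (k : ℕ) :
    coeffMul I u (Finsupp.single k v) = Finsupp.single k (u * v) := by
  change Finsupp.mapRange.linearMap (LinearMap.mulLeft R u) (Finsupp.single k v) = _
  simp only [Finsupp.mapRange.linearMap_apply, Finsupp.mapRange_single, LinearMap.mulLeft_apply]

/-- The derivation of `U(I)` that extends `ad x`. -/
def idealDerivation (I : LieIdeal R M) (x : M) :
    UniversalEnvelopingAlgebra R I →ₗ[R] UniversalEnvelopingAlgebra R I :=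
  derivationExtension (LieModule.toEnd R M I x) (fun y z => by ext; simp)

theorem idealDerivation_ι_mul (x : M) (y : I) (u : UniversalEnvelopingAlgebra R I) :
    idealDerivation I x (UniversalEnvelopingAlgebra.ι R y * u) =
      UniversalEnvelopingAlgebra.ι R ⁅x, y⁆ * u +
        UniversalEnvelopingAlgebra.ι R y * idealDerivation I x u := by
  rw [idealDerivation, derivationExtension_mul, derivationExtension_ι]
  rfl

/-- The action of `x` on the `U(I)`-polynomials, `u t^k ↦ [x, u] t^k + u t^(k+1)`. -/
def polynomialAction (I : LieIdeal R M) (x : M) :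
    Module.End R (ℕ →₀ UniversalEnvelopingAlgebra R I) :=
  Finsupp.mapRange.linearMap (idealDerivation I x) + Finsupp.lmapDomain _ R (· + 1)

theorem polynomialAction_single (x : M) (k : ℕ) (u : UniversalEnvelopingAlgebra R I) :
    polynomialAction I x (Finsupp.single k u) =
      Finsupp.single k (idealDerivation I x u) + Finsupp.single (k + 1) u := by
  simp [polynomialAction]

/-- The relation `x y = y x + [x, y]` of the enveloping algebra, which is all that a representation
of `I ⊕ R x` has to satisfy beyond the relations of `I`. -/
theorem polynomialAction_mul_coeffMul (x : M) (y : I) :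
    polynomialAction I x * coeffMul I (UniversalEnvelopingAlgebra.ι R y) =
      coeffMul I (UniversalEnvelopingAlgebra.ι R y) * polynomialAction I x +
        coeffMul I (UniversalEnvelopingAlgebra.ι R ⁅x, y⁆) := by
  ext k u : 2
  simp only [LinearMap.comp_apply, LinearMap.add_apply, Module.End.mul_apply, coeffMul_single,
    polynomialAction_single, Finsupp.lsingle_apply, map_add, idealDerivation_ι_mul,
    Finsupp.single_add]
  abel

/-- If `I` is an ideal of codimension one, the kernel of `φ`, then `M = I ⊕ R x` acts on the
`U(I)`-polynomials. -/
def codimOneRepresentation (φ : M →ₗ[R] R) (x : M) (hx : φ x = 1)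
    (hφ : ∀ m, m ∈ I ↔ φ m = 0) (hlie : ∀ m n : M, φ ⁅m, n⁆ = 0) :
    M →ₗ⁅R⁆ Module.End R (ℕ →₀ UniversalEnvelopingAlgebra R I) :=
  let π : M →ₗ[R] I := LinearMap.codRestrict I.toSubmodule
    (LinearMap.id - LinearMap.toSpanSingleton R M x ∘ₗ φ) (fun m => (hφ _).2 (by simp [hx]))
  { (coeffMul I).toLinearMap ∘ₗ (UniversalEnvelopingAlgebra.ι R).toLinearMap ∘ₗ π +
      LinearMap.toSpanSingleton R _ (polynomialAction I x) ∘ₗ φ with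
    map_lie' := fun {m n} => by
      -- `π m = m - φ m • x`. The bracket of `M` has no component along `x` since `φ` kills
      -- brackets, and `[x, x] = 0` removes the quadratic term.
      have key : π ⁅m, n⁆ = ⁅π m, π n⁆ + φ m • ⁅x, π n⁆ - φ n • ⁅x, π m⁆ := by
        ext
        have h : ⁅(m : M), x⁆ = - ⁅x, m⁆ := (lie_skew m x).symm
        change (⁅m, n⁆ - φ ⁅m, n⁆ • x : M) = ⁅m - φ m • x, n - φ n • x⁆ +
          φ m • ⁅x, n - φ n • x⁆ - φ n • ⁅x, m - φ m • x⁆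
        rw [hlie]
        simp only [sub_lie, lie_sub, smul_lie, lie_smul, lie_self, h]
        module
      change coeffMul I (UniversalEnvelopingAlgebra.ι R (π ⁅m, n⁆)) +
          φ ⁅m, n⁆ • polynomialAction I x =
        (coeffMul I (UniversalEnvelopingAlgebra.ι R (π m)) + φ m • polynomialAction I x) *
          (coeffMul I (UniversalEnvelopingAlgebra.ι R (π n)) + φ n • polynomialAction I x) -
        (coeffMul I (UniversalEnvelopingAlgebra.ι R (π n)) + φ n • polynomialAction I x) *
          (coeffMul I (UniversalEnvelopingAlgebra.ι R (π m)) + φ m • polynomialAction I x)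
      have h1 : coeffMul I (UniversalEnvelopingAlgebra.ι R ⁅π m, π n⁆) =
          coeffMul I (UniversalEnvelopingAlgebra.ι R (π m)) *
            coeffMul I (UniversalEnvelopingAlgebra.ι R (π n)) -
          coeffMul I (UniversalEnvelopingAlgebra.ι R (π n)) *
            coeffMul I (UniversalEnvelopingAlgebra.ι R (π m)) := by
        rw [LieHom.map_lie, LieRing.of_associative_ring_bracket, map_sub, map_mul, map_mul]
      simp only [add_mul, mul_add, smul_mul_assoc, mul_smul_comm, polynomialAction_mul_coeffMul]
      rw [hlie, key, map_sub, map_add, map_smul, map_smul, map_sub, map_add, map_smul, map_smul, h1]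
      module }

theorem codimOneRepresentation_apply (φ : M →ₗ[R] R) (x : M) (hx : φ x = 1)
    (hφ : ∀ m, m ∈ I ↔ φ m = 0) (hlie : ∀ m n : M, φ ⁅m, n⁆ = 0) :
    codimOneRepresentation φ x hx hφ hlie x = polynomialAction I x := by
  change coeffMul I (UniversalEnvelopingAlgebra.ι R ⟨x - φ x • x, _⟩) +
    φ x • polynomialAction I x = _
  have : (⟨x - φ x • x, (hφ _).2 (by simp [hx])⟩ : I) = 0 := by ext; simp [hx]
  rw [this, hx]
  simp only [map_zero, one_smul, zero_add]

theorem codimOneRepresentation_coe (φ : M →ₗ[R] R) (x : M) (hx : φ x = 1)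
    (hφ : ∀ m, m ∈ I ↔ φ m = 0) (hlie : ∀ m n : M, φ ⁅m, n⁆ = 0) (y : I) :
    codimOneRepresentation φ x hx hφ hlie y = coeffMul I (UniversalEnvelopingAlgebra.ι R y) := by
  have hy : φ y = 0 := (hφ y).1 y.2
  change coeffMul I (UniversalEnvelopingAlgebra.ι R ⟨y - φ y • x, _⟩) +
    φ y • polynomialAction I x = _
  have : (⟨y - φ y • x, (hφ _).2 (by simp [hx])⟩ : I) = y := by ext; simp [hy]
  rw [this, hy, zero_smul, add_zero]

/-- The homomorphism of enveloping algebras that extends the inclusion of an ideal. -/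
def idealInclusion (I : LieIdeal R M) :
    UniversalEnvelopingAlgebra R I →ₐ[R] UniversalEnvelopingAlgebra R M :=
  UniversalEnvelopingAlgebra.lift R ((UniversalEnvelopingAlgebra.ι R (L := M)).comp I.incl)

theorem idealInclusion_ι (y : I) : idealInclusion I (UniversalEnvelopingAlgebra.ι R y) =
    UniversalEnvelopingAlgebra.ι R (y : M) := by
  rw [idealInclusion, UniversalEnvelopingAlgebra.lift_ι_apply]
  rfl

theorem lift_codimOneRepresentation_coe (φ : M →ₗ[R] R) (x : M) (hx : φ x = 1)
    (hφ : ∀ m, m ∈ I ↔ φ m = 0) (hlie : ∀ m n : M, φ ⁅m, n⁆ = 0)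
    (u : UniversalEnvelopingAlgebra R I) :
    UniversalEnvelopingAlgebra.lift R (codimOneRepresentation φ x hx hφ hlie)
      (idealInclusion I u) = coeffMul I u := by
  induction u using enveloping_induction with
  | one => simp only [map_one]
  | ι_mul y u hu =>
    rw [map_mul, map_mul, map_mul, hu, idealInclusion_ι, UniversalEnvelopingAlgebra.lift_ι_apply,
      codimOneRepresentation_coe]
  | add u v hu hv => rw [map_add, map_add, map_add, hu, hv]
  | smul t u hu => rw [map_smul, map_smul, map_smul, hu]

theorem polynomialAction_pow_single_one (x : M) (k : ℕ) :
    (polynomialAction I x ^ k) (Finsupp.single 0 1) = Finsupp.single k 1 := by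
  induction k with
  | zero => simp
  | succ k ih =>
    rw [pow_succ', Module.End.mul_apply, ih, polynomialAction_single, idealDerivation,
      derivationExtension_one, Finsupp.single_zero, zero_add]

end Extension

/-! ### Linear independence of the ordered monomials -/

section Independence

variable {R : Type u} [CommRing R]

theorem monomial_succ {M : Type v} [LieRing M] [LieAlgebra R M] {r : ℕ}
    (b : Module.Basis (Fin (r + 1)) R M) (α : Fin (r + 1) → ℕ) :
    monomial b α = (List.ofFn fun i : Fin r =>
      UniversalEnvelopingAlgebra.ι R (b i.castSucc) ^ α i.castSucc).prod *
        UniversalEnvelopingAlgebra.ι R (b (Fin.last r)) ^ α (Fin.last r) := by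
  rw [monomial, List.ofFn_succ', List.prod_concat]

/-- Poincaré-Birkhoff-Witt, for a basis all whose initial segments span ideals with trivial action
on the successive quotients: the ordered monomials are linearly independent. -/
theorem linearIndependent_monomial : ∀ (r : ℕ) {M : Type v} [LieRing M] [LieAlgebra R M]
    (b : Module.Basis (Fin r) R M),
    (∀ i j, ⁅b i, b j⁆ ∈ Submodule.span R (b '' {l | l < i})) →
    LinearIndependent R (monomial b)
  | 0, M, _, _, b, _ => by
    -- In rank zero the only monomial is `1`, which the augmentation sends to `1`.
    refine LinearIndependent.of_comp
      (UniversalEnvelopingAlgebra.lift R (0 : M →ₗ⁅R⁆ R)).toLinearMap ?_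
    rw [Fintype.linearIndependent_iff]
    intro g hg α
    rw [Subsingleton.elim α default]
    have h : g default = 0 := by
      rw [← hg, Fintype.sum_unique]
      simp only [monomial, List.ofFn_zero, List.prod_nil, Function.comp_apply,
        AlgHom.toLinearMap_apply, map_one, smul_eq_mul, mul_one]
      exact congrArg g (Subsingleton.elim _ _)
    exact h
  | r + 1, M, _, _, b, hb => by
    let φ : M →ₗ[R] R := b.coord (Fin.last r)
    let x := b (Fin.last r)
    have hx : φ x = 1 := by simp [φ, x]
    have hker : ∀ i, Submodule.span R (b '' {l | l < i}) ≤ LinearMap.ker φ := by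
      intro i
      rw [Submodule.span_le]
      rintro _ ⟨l, hl, rfl⟩
      have : l ≠ Fin.last r := (lt_of_lt_of_le (show l < i from hl) (Fin.le_last i)).ne
      simp [φ, this]
    have hlie : ∀ m n : M, φ ⁅m, n⁆ = 0 := by
      have h : (LieModule.toEnd R M M : M →ₗ[R] Module.End R M).compr₂ φ = 0 :=
        b.ext fun i => b.ext fun j => by simpa using hker i (hb i j)
      intro m n
      exact DFunLike.congr_fun (DFunLike.congr_fun h m) n
    let I : LieIdeal R M := { LinearMap.ker φ with lie_mem := fun {m n} _ => hlie m n }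
    have hI : ∀ m, m ∈ I ↔ φ m = 0 := fun m => Iff.rfl
    have hb' : ∀ i : Fin r, b i.castSucc ∈ I := fun i => by
      simp [hI, φ, (Fin.castSucc_lt_last i).ne]
    have hbI : ∀ i : Fin r, I.toSubmodule.subtype ⟨b i.castSucc, hb' i⟩ = b i.castSucc :=
      fun i => rfl
    have hspan : ∀ (m : M) (h : m ∈ I) (s : Set (Fin (r + 1))),
        m ∈ Submodule.span R (b '' s) → (⟨m, h⟩ : I) ∈ Submodule.span R
          ((fun i : Fin r => (⟨b i.castSucc, hb' i⟩ : I)) '' {i | i.castSucc ∈ s}) := by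
      intro m h s hm
      have hm' : (⟨m, h⟩ : I) =
          ∑ i : Fin r, b.repr m i.castSucc • (⟨b i.castSucc, hb' i⟩ : I) := by
        apply I.toSubmodule.injective_subtype
        rw [map_sum]
        simp only [map_smul, hbI]
        have h0 : b.repr m (Fin.last r) = 0 := h
        have h1 := b.sum_repr m
        rw [Fin.sum_univ_castSucc, h0, zero_smul, add_zero] at h1
        exact h1.symm
      rw [hm']
      refine Submodule.sum_mem _ fun i _ => ?_
      by_cases hi : b.repr m i.castSucc = 0
      · rw [hi, zero_smul]
        exact Submodule.zero_mem _
      · exact Submodule.smul_mem _ _ (Submodule.subset_span ⟨i, b.mem_span_image.1 hm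
          (Finsupp.mem_support_iff.2 hi), rfl⟩)
    have hli : LinearIndependent R (fun i : Fin r => (⟨b i.castSucc, hb' i⟩ : I)) :=
      LinearIndependent.of_comp I.toSubmodule.subtype
        (b.linearIndependent.comp _ (Fin.castSucc_injective r))
    let b' : Module.Basis (Fin r) R I := Module.Basis.mk hli (by
      rintro ⟨m, hm⟩ -
      have := hspan m hm Set.univ (by simp)
      exact Submodule.span_mono (Set.image_subset_range _ _) this)
    have hbb : ∀ i, b' i = ⟨b i.castSucc, hb' i⟩ := fun i => by simp [b']
    have ih := linearIndependent_monomial r b' (fun i j => by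
      have := hspan _ (LieSubmodule.lie_mem I (x := b i.castSucc) (hb' j)) _
        (hb i.castSucc j.castSucc)
      rw [show (b' : Fin r → I) = fun i => ⟨b i.castSucc, hb' i⟩ from funext hbb]
      exact this)
    let f := UniversalEnvelopingAlgebra.lift R (codimOneRepresentation φ x hx hI hlie)
    -- Let a monomial act on `1 · t^0`: the power of the last element produces `t^k`, and the
    -- remaining letters lie in `I` and multiply the coefficient.
    refine LinearIndependent.of_comp
      (LinearMap.applyₗ (Finsupp.single 0 1) ∘ₗ f.toLinearMap) ?_
    have h1 : (LinearMap.applyₗ (Finsupp.single 0 1) ∘ₗ f.toLinearMap) ∘ monomial b =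
        (fun kβ : (_ : ℕ) × (Fin r → ℕ) => Finsupp.single kβ.1 (monomial b' kβ.2)) ∘
          fun α => ⟨α (Fin.last r), fun i => α i.castSucc⟩ := by
      ext α : 1
      change f (monomial b α) (Finsupp.single 0 1) = _
      have h2 : (List.ofFn fun i : Fin r =>
          UniversalEnvelopingAlgebra.ι R (b i.castSucc) ^ α i.castSucc).prod =
          idealInclusion I (monomial b' fun i => α i.castSucc) := by
        rw [monomial, map_list_prod, List.map_ofFn]
        congr 2
        ext i
        simp only [Function.comp_apply, map_pow, idealInclusion_ι, hbb]
      rw [monomial_succ, map_mul, Module.End.mul_apply, map_pow, h2]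
      simp only [f]
      rw [lift_codimOneRepresentation_coe, UniversalEnvelopingAlgebra.lift_ι_apply,
        codimOneRepresentation_apply, polynomialAction_pow_single_one, coeffMul_single, mul_one]
      rfl
    rw [h1]
    refine LinearIndependent.comp (ι := (_ : ℕ) × (Fin r → ℕ))
      (Finsupp.linearIndependent_single (f := fun _ => monomial b') fun _ => ih) _ ?_
    intro α β h
    simp only [Sigma.mk.injEq, heq_eq_eq] at h
    ext i
    induction i using Fin.lastCases with
    | last => exact h.1
    | cast i => exact congrFun h.2 i

end Independence

/-! ### Sorting words, and the weight filtration -/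

section Words

variable {R : Type u} [CommRing R] {M : Type v} [LieRing M] [LieAlgebra R M] {r : ℕ}

/-- The product in the enveloping algebra of the basis elements indexed by a list. -/
def wordProd (b : Module.Basis (Fin r) R M) (l : List (Fin r)) : UniversalEnvelopingAlgebra R M :=
  (l.map fun i => UniversalEnvelopingAlgebra.ι R (b i)).prod

/-- The sum of the weights of the letters of a word. -/
def wordWeight (w : Fin r → ℕ) (l : List (Fin r)) : ℕ := (l.map w).sum

/-- The span of the products of fewer than `n` basis elements of total weight at least `m`. -/
def shortWords (b : Module.Basis (Fin r) R M) (w : Fin r → ℕ) (n m : ℕ) :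
    Submodule R (UniversalEnvelopingAlgebra R M) :=
  Submodule.span R (wordProd b '' {l | l.length < n ∧ m ≤ wordWeight w l})

/-- The span of the ordered monomials of weight at least `m`. -/
def weightFiltration (b : Module.Basis (Fin r) R M) (w : Fin r → ℕ) (m : ℕ) :
    Submodule R (UniversalEnvelopingAlgebra R M) :=
  Submodule.span R (monomial b '' {α | m ≤ ∑ i, α i * w i})

@[simp]
theorem wordProd_cons (b : Module.Basis (Fin r) R M) (i : Fin r) (l : List (Fin r)) :
    wordProd b (i :: l) = UniversalEnvelopingAlgebra.ι R (b i) * wordProd b l := by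
  simp [wordProd, -UniversalEnvelopingAlgebra.ι_apply]

@[simp]
theorem wordWeight_cons (w : Fin r → ℕ) (i : Fin r) (l : List (Fin r)) :
    wordWeight w (i :: l) = w i + wordWeight w l := by
  simp [wordWeight]

theorem wordWeight_perm (w : Fin r → ℕ) {l l' : List (Fin r)} (h : l.Perm l') :
    wordWeight w l = wordWeight w l' :=
  (h.map w).sum_eq

theorem ι_mul_mem_shortWords (b : Module.Basis (Fin r) R M) (w : Fin r → ℕ) {n m k : ℕ} {x : M}
    (hx : x ∈ Submodule.span R (b '' {i | k ≤ w i})) {u : UniversalEnvelopingAlgebra R M}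
    (hu : u ∈ shortWords b w n m) :
    UniversalEnvelopingAlgebra.ι R x * u ∈ shortWords b w (n + 1) (k + m) := by
  have key : ∀ i ∈ {i | k ≤ w i}, ∀ v ∈ shortWords b w n m,
      UniversalEnvelopingAlgebra.ι R (b i) * v ∈ shortWords b w (n + 1) (k + m) := by
    intro i hi v hv
    have : shortWords b w n m ≤ (shortWords b w (n + 1) (k + m)).comap
        (LinearMap.mulLeft R (UniversalEnvelopingAlgebra.ι R (b i))) := by
      refine Submodule.span_le.2 ?_
      rintro _ ⟨l, ⟨hl, hl'⟩, rfl⟩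
      refine Submodule.subset_span ⟨i :: l, ⟨by simpa using hl, ?_⟩, wordProd_cons b i l⟩
      rw [wordWeight_cons]
      exact add_le_add hi hl'
    exact this hv
  have : Submodule.span R (b '' {i | k ≤ w i}) ≤ (shortWords b w (n + 1) (k + m)).comap
      ((LinearMap.mulRight R u) ∘ₗ (UniversalEnvelopingAlgebra.ι R).toLinearMap) := by
    refine Submodule.span_le.2 ?_
    rintro _ ⟨i, hi, rfl⟩
    exact key i hi u hu
  exact this hx

theorem mem_span_weight (b : Module.Basis (Fin r) R M) (w : Fin r → ℕ) (i : Fin r) :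
    b i ∈ Submodule.span R (b '' {j | w i ≤ w j}) :=
  Submodule.subset_span ⟨i, le_refl (w i), rfl⟩

/-- A transposition of adjacent letters leaves their bracket, a combination of single letters of
weight at least the sum of the two: the length drops by one and the weight does not drop. -/
theorem wordProd_sub_mem_of_perm (b : Module.Basis (Fin r) R M) (w : Fin r → ℕ)
    (hb : ∀ i j, ⁅b i, b j⁆ ∈ Submodule.span R (b '' {l | w i + w j ≤ w l}))
    {l l' : List (Fin r)} (h : l.Perm l') :
    wordProd b l - wordProd b l' ∈ shortWords b w l.length (wordWeight w l) := by
  induction h with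
  | nil => simp
  | cons i h ih =>
    rw [wordProd_cons, wordProd_cons, ← mul_sub, List.length_cons, wordWeight_cons]
    exact ι_mul_mem_shortWords b w (mem_span_weight b w i) ih
  | swap i j l =>
    have hl : wordProd b l ∈ shortWords b w (l.length + 1) (wordWeight w l) :=
      Submodule.subset_span ⟨l, ⟨Nat.lt_succ_self _, le_refl _⟩, rfl⟩
    have := ι_mul_mem_shortWords b w (hb j i) hl
    rw [LieHom.map_lie, LieRing.of_associative_ring_bracket] at this
    simpa only [wordProd_cons, wordWeight_cons, List.length_cons, ← mul_assoc, ← sub_mul,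
      ← add_assoc] using this
  | trans h₁ h₂ ih₁ ih₂ =>
    rw [← h₁.length_eq, ← wordWeight_perm w h₁] at ih₂
    simpa using Submodule.add_mem _ ih₁ ih₂

/-- The nondecreasing word with prescribed multiplicities. -/
def orderedWord (α : Fin r → ℕ) : List (Fin r) :=
  (List.ofFn fun i => List.replicate (α i) i).flatten

theorem wordProd_orderedWord (b : Module.Basis (Fin r) R M) (α : Fin r → ℕ) :
    wordProd b (orderedWord α) = monomial b α := by
  rw [wordProd, orderedWord, monomial, List.map_flatten, List.prod_flatten, List.map_map,
    List.map_ofFn]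
  congr 2
  ext i
  simp [-UniversalEnvelopingAlgebra.ι_apply]

theorem wordWeight_orderedWord (w : Fin r → ℕ) (α : Fin r → ℕ) :
    wordWeight w (orderedWord α) = ∑ i, α i * w i := by
  rw [wordWeight, orderedWord, List.map_flatten, List.sum_flatten, List.map_map, List.map_ofFn,
    List.sum_ofFn]
  simp

theorem perm_orderedWord (l : List (Fin r)) : l.Perm (orderedWord fun i => l.count i) := by
  rw [List.perm_iff_count]
  intro a
  rw [orderedWord, List.count_flatten, List.map_ofFn, List.sum_ofFn]
  simp [List.count_replicate]

/-- Induction on the length: a word equals its sorted form modulo strictly shorter words of no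
smaller weight. -/
theorem shortWords_le_weightFiltration (b : Module.Basis (Fin r) R M) (w : Fin r → ℕ)
    (hb : ∀ i j, ⁅b i, b j⁆ ∈ Submodule.span R (b '' {l | w i + w j ≤ w l})) (n m : ℕ) :
    shortWords b w n m ≤ weightFiltration b w m := by
  induction n with
  | zero => simp [shortWords]
  | succ n ih =>
    refine Submodule.span_le.2 ?_
    rintro _ ⟨l, ⟨hl, hm⟩, rfl⟩
    have h := wordProd_sub_mem_of_perm b w hb (perm_orderedWord l)
    have h1 : shortWords b w l.length (wordWeight w l) ≤ shortWords b w n m :=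
      Submodule.span_mono (Set.image_mono fun l' hl' =>
        ⟨lt_of_lt_of_le hl'.1 (Nat.lt_succ_iff.1 hl), hm.trans hl'.2⟩)
    have h2 : wordProd b (orderedWord fun i => l.count i) ∈ weightFiltration b w m := by
      refine Submodule.subset_span ⟨_, ?_, (wordProd_orderedWord b _).symm⟩
      rw [Set.mem_ofPred_eq, ← wordWeight_orderedWord, ← wordWeight_perm w (perm_orderedWord l)]
      exact hm
    simpa using Submodule.add_mem _ (ih (h1 h)) h2

theorem wordProd_mem_weightFiltration (b : Module.Basis (Fin r) R M) (w : Fin r → ℕ)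
    (hb : ∀ i j, ⁅b i, b j⁆ ∈ Submodule.span R (b '' {l | w i + w j ≤ w l})) {m : ℕ}
    {l : List (Fin r)} (hm : m ≤ wordWeight w l) : wordProd b l ∈ weightFiltration b w m :=
  shortWords_le_weightFiltration b w hb (l.length + 1) m
    (Submodule.subset_span ⟨l, ⟨Nat.lt_succ_self _, hm⟩, rfl⟩)

/-- With the order of the letters forgotten, stability under products and derivations can be checked
letter by letter. -/
theorem weightFiltration_eq_span_words (b : Module.Basis (Fin r) R M) (w : Fin r → ℕ)
    (hb : ∀ i j, ⁅b i, b j⁆ ∈ Submodule.span R (b '' {l | w i + w j ≤ w l})) (m : ℕ) :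
    weightFiltration b w m = Submodule.span R (wordProd b '' {l | m ≤ wordWeight w l}) := by
  refine le_antisymm (Submodule.span_le.2 ?_) (Submodule.span_le.2 ?_)
  · rintro _ ⟨α, hα, rfl⟩
    refine Submodule.subset_span ⟨orderedWord α, ?_, wordProd_orderedWord b α⟩
    rw [Set.mem_ofPred_eq, wordWeight_orderedWord]
    exact hα
  · rintro _ ⟨l, hl, rfl⟩
    exact wordProd_mem_weightFiltration b w hb hl

theorem ι_mul_mem_weightFiltration (b : Module.Basis (Fin r) R M) (w : Fin r → ℕ)
    (hb : ∀ i j, ⁅b i, b j⁆ ∈ Submodule.span R (b '' {l | w i + w j ≤ w l})) {m k : ℕ} {x : M}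
    (hx : x ∈ Submodule.span R (b '' {i | k ≤ w i})) {u : UniversalEnvelopingAlgebra R M}
    (hu : u ∈ weightFiltration b w m) :
    UniversalEnvelopingAlgebra.ι R x * u ∈ weightFiltration b w (k + m) := by
  rw [weightFiltration_eq_span_words b w hb] at hu
  have : Submodule.span R (wordProd b '' {l | m ≤ wordWeight w l}) ≤
      (weightFiltration b w (k + m)).comap
        (LinearMap.mulLeft R (UniversalEnvelopingAlgebra.ι R x)) := by
    refine Submodule.span_le.2 ?_
    rintro _ ⟨l, hl, rfl⟩
    exact shortWords_le_weightFiltration b w hb _ _ (ι_mul_mem_shortWords b w hx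
      (Submodule.subset_span ⟨l, ⟨Nat.lt_succ_self _, hl⟩, rfl⟩))
  exact this hu

theorem weightFiltration_mono (b : Module.Basis (Fin r) R M) (w : Fin r → ℕ) {m n : ℕ}
    (h : m ≤ n) : weightFiltration b w n ≤ weightFiltration b w m :=
  Submodule.span_mono (Set.image_mono fun _ hα => h.trans hα)

theorem weightFiltration_zero (b : Module.Basis (Fin r) R M) (w : Fin r → ℕ)
    (hb : ∀ i j, ⁅b i, b j⁆ ∈ Submodule.span R (b '' {l | w i + w j ≤ w l})) :
    weightFiltration b w 0 = ⊤ := by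
  rw [eq_top_iff]
  rintro u -
  induction u using enveloping_induction with
  | one =>
    have h := wordProd_mem_weightFiltration b w hb (l := []) (Nat.zero_le _)
    rwa [wordProd, List.map_nil, List.prod_nil] at h
  | ι_mul x u hu =>
    have hx : x ∈ Submodule.span R (b '' {i | 0 ≤ w i}) := by simp
    have h := ι_mul_mem_weightFiltration b w hb hx hu
    rwa [add_zero] at h
  | add u v hu hv => exact Submodule.add_mem _ hu hv
  | smul t u hu => exact Submodule.smul_mem _ t hu

theorem derivation_mem_weightFiltration (b : Module.Basis (Fin r) R M) (w : Fin r → ℕ)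
    (hb : ∀ i j, ⁅b i, b j⁆ ∈ Submodule.span R (b '' {l | w i + w j ≤ w l}))
    {D : M →ₗ[R] M} (hD : ∀ i, D (b i) ∈ Submodule.span R (b '' {l | w i ≤ w l}))
    {E : UniversalEnvelopingAlgebra R M →ₗ[R] UniversalEnvelopingAlgebra R M}
    (hE : IsDerivationExtension D E) {m : ℕ} {u : UniversalEnvelopingAlgebra R M}
    (hu : u ∈ weightFiltration b w m) : E u ∈ weightFiltration b w m := by
  have key : ∀ l, E (wordProd b l) ∈ weightFiltration b w (wordWeight w l) := by
    intro l
    induction l with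
    | nil =>
      have h1 : E 1 = 0 := by simpa using hE.1 1 1
      simp [wordProd, h1]
    | cons i l ih =>
      rw [wordProd_cons, hE.1, hE.2, wordWeight_cons]
      exact Submodule.add_mem _
        (ι_mul_mem_weightFiltration b w hb (hD i)
          (wordProd_mem_weightFiltration b w hb (le_refl _)))
        (ι_mul_mem_weightFiltration b w hb (mem_span_weight b w i) ih)
  rw [weightFiltration_eq_span_words b w hb] at hu
  have : Submodule.span R (wordProd b '' {l | m ≤ wordWeight w l}) ≤
      (weightFiltration b w m).comap E := by
    refine Submodule.span_le.2 ?_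
    rintro _ ⟨l, hl, rfl⟩
    exact weightFiltration_mono b w hl (key l)
  exact this hu

/-- The basis of ordered monomials (Poincaré-Birkhoff-Witt). -/
def monomialBasis (b : Module.Basis (Fin r) R M) (w : Fin r → ℕ)
    (hb : ∀ i j, ⁅b i, b j⁆ ∈ Submodule.span R (b '' {l | w i + w j ≤ w l}))
    (hb' : ∀ i j, ⁅b i, b j⁆ ∈ Submodule.span R (b '' {l | l < i})) :
    Module.Basis (Fin r → ℕ) R (UniversalEnvelopingAlgebra R M) :=
  Module.Basis.mk (linearIndependent_monomial r b hb') (by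
    have h := weightFiltration_zero b w hb
    rw [weightFiltration] at h
    simpa using h.ge)

end Words

/-! ### Quotient by the span of part of a basis -/

section Quotient

variable {R : Type u} [CommRing R] {V : Type v} [AddCommGroup V] [Module R V] {ι : Type*}

/-- The quotient by the span of a part of a basis. -/
def quotientSpanEquiv (B : Module.Basis ι R V) (s : Set ι) :
    (V ⧸ Submodule.span R (B '' s)) ≃ₗ[R] ((sᶜ : Set ι) →₀ R) :=
  have h : IsCompl (Submodule.span R (B '' s)) (Submodule.span R (B '' sᶜ)) := by
    refine ⟨(B.linearIndependent).disjoint_span_image disjoint_compl_right, ?_⟩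
    rw [codisjoint_iff, ← Submodule.span_union, ← Set.image_union, Set.union_compl_self,
      Set.image_univ, B.span_eq]
  (Submodule.quotientEquivOfIsCompl _ _ h).trans
    ((LinearEquiv.ofEq _ _ (by rw [Set.image_eq_range]; rfl)).trans
      (Module.Basis.span (B.linearIndependent.comp ((↑) : (sᶜ : Set ι) → ι)
        Subtype.val_injective)).repr)

end Quotient

/-! ### Nilpotency of the radical (Fitting) -/

section Radical

variable {R : Type u} [CommRing R] {L : Type v} [LieRing L] [LieAlgebra R L]

theorem coe_lowerCentralSeries_self_le_lcs (I : LieIdeal R L) (k : ℕ) :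
    (LieModule.lowerCentralSeries R I I k).toSubmodule.map I.toSubmodule.subtype ≤
      (I.lcs L k).toSubmodule := by
  induction k with
  | zero => simp
  | succ k ih =>
    rw [LieModule.lowerCentralSeries_succ, LieSubmodule.lieIdeal_oper_eq_linear_span',
      Submodule.map_span, Submodule.span_le]
    rintro _ ⟨_, ⟨x, -, y, hy, rfl⟩, rfl⟩
    rw [LieIdeal.lcs_succ]
    exact LieSubmodule.lie_mem_lie x.2 (ih ⟨y, hy, rfl⟩)

/-- The series `I.lcs L` starts at `L` instead of `I`, hence the shift by one. Its terms are ideals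
of `L`, so the series of two different ideals can be intersected. -/
theorem lcs_succ_le_coe_lowerCentralSeries_self (I : LieIdeal R L) (k : ℕ) :
    (I.lcs L (k + 1)).toSubmodule ≤
      (LieModule.lowerCentralSeries R I I k).toSubmodule.map I.toSubmodule.subtype := by
  induction k with
  | zero =>
    intro x hx
    have hx' : x ∈ I := by
      rw [LieIdeal.lcs_succ] at hx
      exact LieSubmodule.lie_le_left I _ hx
    exact ⟨⟨x, hx'⟩, by simp, rfl⟩
  | succ k ih =>
    rw [LieIdeal.lcs_succ, LieSubmodule.lieIdeal_oper_eq_linear_span', Submodule.span_le]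
    rintro _ ⟨x, hx, y, hy, rfl⟩
    obtain ⟨z, hz, rfl⟩ := ih hy
    refine ⟨⁅(⟨x, hx⟩ : I), z⁆, ?_, rfl⟩
    rw [LieModule.lowerCentralSeries_succ]
    exact LieSubmodule.lie_mem_lie (LieSubmodule.mem_top _) hz

theorem isNilpotent_iff_exists_lcs_eq_bot (I : LieIdeal R L) :
    LieRing.IsNilpotent I ↔ ∃ k, I.lcs L k = ⊥ := by
  rw [LieRing.IsNilpotent, LieModule.isNilpotent_iff R]
  constructor
  · rintro ⟨k, hk⟩
    refine ⟨k + 1, ?_⟩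
    have h := lcs_succ_le_coe_lowerCentralSeries_self I k
    rw [hk] at h
    rw [← LieSubmodule.toSubmodule_eq_bot, eq_bot_iff]
    simpa using h
  · rintro ⟨k, hk⟩
    refine ⟨k, ?_⟩
    have h := coe_lowerCentralSeries_self_le_lcs I k
    rw [hk] at h
    rw [← LieSubmodule.toSubmodule_eq_bot, eq_bot_iff]
    intro x hx
    have := h ⟨x, hx, rfl⟩
    simpa using this

theorem lcs_antitone (I : LieIdeal R L) : Antitone (I.lcs L) :=
  antitone_nat_of_succ_le fun k => by
    rw [LieIdeal.lcs_succ]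
    exact LieSubmodule.lie_le_right _ _

theorem iterate_lie_sup (I N N' : LieIdeal R L) (n : ℕ) :
    (fun X => ⁅I, X⁆)^[n] (N ⊔ N') = (fun X => ⁅I, X⁆)^[n] N ⊔ (fun X => ⁅I, X⁆)^[n] N' := by
  induction n generalizing N N' with
  | zero => rfl
  | succ n ih => rw [Function.iterate_succ_apply, LieSubmodule.lie_sup, ih]; rfl

theorem iterate_lie_mono (I : LieIdeal R L) (n : ℕ) :
    Monotone ((fun X : LieIdeal R L => ⁅I, X⁆)^[n]) :=
  Monotone.iterate (fun _ _ h => LieSubmodule.mono_lie_right I h) n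

/-- Each bracket with `I ⊔ J` advances one of the two series and leaves the other where it is, as
its terms are ideals. After enough brackets `a ≥ p` or `b ≥ q`, and one of the terms is zero. -/
theorem iterate_sup_lie_eq_bot (I J : LieIdeal R L) {p q : ℕ} (hp : I.lcs L p = ⊥)
    (hq : J.lcs L q = ⊥) (n a b : ℕ) (h : p + q ≤ n + a + b) :
    (fun X : LieIdeal R L => ⁅I ⊔ J, X⁆)^[n] (I.lcs L a ⊓ J.lcs L b) = ⊥ := by
  induction n generalizing a b with
  | zero =>
    rw [Function.iterate_zero_apply, eq_bot_iff]
    rcases le_or_gt p a with hpa | hpa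
    · exact inf_le_left.trans ((lcs_antitone I hpa).trans hp.le)
    · exact inf_le_right.trans ((lcs_antitone J (by omega)).trans hq.le)
  | succ n ih =>
    have h1 : ⁅I ⊔ J, I.lcs L a ⊓ J.lcs L b⁆ ≤
        (I.lcs L (a + 1) ⊓ J.lcs L b) ⊔ (I.lcs L a ⊓ J.lcs L (b + 1)) := by
      rw [LieSubmodule.sup_lie]
      refine sup_le_sup (le_inf ?_ ?_) (le_inf ?_ ?_)
      · rw [LieIdeal.lcs_succ]
        exact LieSubmodule.mono_lie_right I inf_le_left
      · exact (LieSubmodule.lie_le_right _ _).trans inf_le_right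
      · exact (LieSubmodule.lie_le_right _ _).trans inf_le_left
      · rw [LieIdeal.lcs_succ]
        exact LieSubmodule.mono_lie_right J inf_le_right
    rw [Function.iterate_succ_apply, eq_bot_iff]
    refine (iterate_lie_mono _ n h1).trans ?_
    rw [iterate_lie_sup, ih _ _ (by omega), ih _ _ (by omega), bot_sup_eq]

theorem isNilpotent_sup (I J : LieIdeal R L) (hI : LieRing.IsNilpotent I)
    (hJ : LieRing.IsNilpotent J) : LieRing.IsNilpotent (I ⊔ J : LieIdeal R L) := by
  obtain ⟨p, hp⟩ := (isNilpotent_iff_exists_lcs_eq_bot I).1 hI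
  obtain ⟨q, hq⟩ := (isNilpotent_iff_exists_lcs_eq_bot J).1 hJ
  refine (isNilpotent_iff_exists_lcs_eq_bot _).2 ⟨p + q, ?_⟩
  have := iterate_sup_lie_eq_bot I J hp hq (p + q) 0 0 (by omega)
  simpa [LieIdeal.lcs] using this

/-- In a Noetherian module a nonempty set of ideals closed under binary sums contains its supremum.
-/
theorem isNilpotent_nilpotentRadical [IsNoetherian R L] :
    LieRing.IsNilpotent (nilpotentRadical R L) := by
  have h := CompleteLattice.WellFoundedGT.isSupClosedCompact (LieIdeal R L) inferInstance
  refine h {I : LieIdeal R L | LieRing.IsNilpotent I} ⟨⊥, ?_⟩ fun I hI J hJ =>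
    isNilpotent_sup I J hI hJ
  exact (isNilpotent_iff_exists_lcs_eq_bot _).2 ⟨1, by simp⟩

end Radical

/-! ### The isolated lower central series -/

section IsolatedSeries

variable {R : Type u} [CommRing R] [IsDomain R] {M : Type v} [LieRing M] [LieAlgebra R M]

theorem one_tmul_mem_baseChange_iff {V : Type v} [AddCommGroup V] [Module R V]
    (P : Submodule R V) (x : V) :
    (1 : FractionRing R) ⊗ₜ[R] x ∈ P.baseChange (FractionRing R) ↔
      ∃ a : R, a ≠ 0 ∧ a • x ∈ P := by
  have hP : P.baseChange (FractionRing R) = P.localized' (FractionRing R) (nonZeroDivisors R)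
      (TensorProduct.mk R (FractionRing R) V 1) := by
    rw [Submodule.localized'_eq_span, Submodule.baseChange_eq_span, Submodule.map_coe]
  rw [hP, Submodule.mem_localized']
  constructor
  · rintro ⟨m, hm, s, h⟩
    rw [IsLocalizedModule.mk'_eq_iff, Submonoid.smul_def, ← TensorProduct.mk_apply,
      ← LinearMap.map_smul] at h
    obtain ⟨t, ht⟩ := (IsLocalizedModule.eq_iff_exists (nonZeroDivisors R)
      (TensorProduct.mk R (FractionRing R) V 1)).1 h
    refine ⟨t * s, mul_ne_zero (nonZeroDivisors.ne_zero t.2) (nonZeroDivisors.ne_zero s.2), ?_⟩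
    rw [mul_smul]
    rw [Submonoid.smul_def, Submonoid.smul_def] at ht
    rw [← ht]
    exact P.smul_mem _ hm
  · rintro ⟨a, ha, hax⟩
    refine ⟨a • x, hax, ⟨a, mem_nonZeroDivisors_of_ne_zero ha⟩, ?_⟩
    rw [IsLocalizedModule.mk'_eq_iff, Submonoid.smul_def, ← TensorProduct.mk_apply,
      ← LinearMap.map_smul]

/-- Clearing denominators: the isolated series is the saturation of the lower central series over
`R`, so the fraction field is not needed below. -/
theorem mem_isolatedSeries_iff {m : ℕ} {x : M} : x ∈ isolatedSeries R M m ↔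
    ∃ a : R, a ≠ 0 ∧ a • x ∈ LieModule.lowerCentralSeries R M M (m - 1) := by
  rw [isolatedSeries, LieSubmodule.lowerCentralSeries_tensor_eq_baseChange]
  exact one_tmul_mem_baseChange_iff _ _

theorem lowerCentralSeries_le_isolatedSeries (m : ℕ) :
    (LieModule.lowerCentralSeries R M M (m - 1)).toSubmodule ≤ isolatedSeries R M m :=
  fun _ hx => mem_isolatedSeries_iff.2 ⟨1, one_ne_zero, by simpa using hx⟩

theorem mem_isolatedSeries_of_smul {m : ℕ} {x : M} {a : R} (ha : a ≠ 0)
    (h : a • x ∈ isolatedSeries R M m) : x ∈ isolatedSeries R M m := by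
  obtain ⟨b, hb, hbx⟩ := mem_isolatedSeries_iff.1 h
  exact mem_isolatedSeries_iff.2 ⟨b * a, mul_ne_zero hb ha, by rwa [mul_smul]⟩

theorem isolatedSeries_antitone : Antitone (isolatedSeries R M) := fun m n h x hx => by
  obtain ⟨a, ha, hax⟩ := mem_isolatedSeries_iff.1 hx
  exact mem_isolatedSeries_iff.2
    ⟨a, ha, LieModule.antitone_lowerCentralSeries R M M (Nat.sub_le_sub_right h 1) hax⟩

theorem isolatedSeries_eq_top {m : ℕ} (hm : m ≤ 1) : isolatedSeries R M m = ⊤ := by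
  rw [eq_top_iff]
  intro x _
  refine mem_isolatedSeries_iff.2 ⟨1, one_ne_zero, ?_⟩
  rw [Nat.sub_eq_zero_of_le hm]
  simp

/-- With the shifted numbering this is `[γ_i, γ_j] ⊆ γ_{i+j}`. By the Jacobi identity a generator
`[z, n]` of the first factor gives `[z, [n, y]] - [n, [z, y]]`. -/
theorem lie_mem_lowerCentralSeries {i j : ℕ} {x y : M}
    (hx : x ∈ LieModule.lowerCentralSeries R M M i)
    (hy : y ∈ LieModule.lowerCentralSeries R M M j) :
    ⁅x, y⁆ ∈ LieModule.lowerCentralSeries R M M (i + j + 1) := by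
  induction i generalizing j x y with
  | zero =>
    rw [zero_add, LieModule.lowerCentralSeries_succ]
    exact LieSubmodule.lie_mem_lie (LieSubmodule.mem_top x) hy
  | succ i ih =>
    rw [LieModule.lowerCentralSeries_succ, ← LieSubmodule.mem_toSubmodule,
      LieSubmodule.lieIdeal_oper_eq_linear_span'] at hx
    have : Submodule.span R {m : M | ∃ x ∈ (⊤ : LieIdeal R M),
        ∃ n ∈ LieModule.lowerCentralSeries R M M i, ⁅x, n⁆ = m} ≤
        (LieModule.lowerCentralSeries R M M (i + 1 + j + 1)).toSubmodule.comap
          ((LieModule.toEnd R M M : M →ₗ[R] Module.End R M).flip y) := by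
      refine Submodule.span_le.2 ?_
      rintro _ ⟨z, -, n, hn, rfl⟩
      change ⁅⁅z, n⁆, y⁆ ∈ LieModule.lowerCentralSeries R M M (i + 1 + j + 1)
      rw [lie_lie]
      refine sub_mem ?_ ?_
      · rw [show i + 1 + j + 1 = (i + j + 1) + 1 by ring, LieModule.lowerCentralSeries_succ]
        exact LieSubmodule.lie_mem_lie (LieSubmodule.mem_top z) (ih hn hy)
      · rw [show i + 1 + j + 1 = i + (j + 1) + 1 by ring]
        refine ih hn ?_
        rw [LieModule.lowerCentralSeries_succ]
        exact LieSubmodule.lie_mem_lie (LieSubmodule.mem_top z) hy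
    exact this hx

theorem lie_mem_isolatedSeries {m n : ℕ} (hm : 1 ≤ m) (hn : 1 ≤ n) {x y : M}
    (hx : x ∈ isolatedSeries R M m) (hy : y ∈ isolatedSeries R M n) :
    ⁅x, y⁆ ∈ isolatedSeries R M (m + n) := by
  obtain ⟨a, ha, hax⟩ := mem_isolatedSeries_iff.1 hx
  obtain ⟨b, hb, hby⟩ := mem_isolatedSeries_iff.1 hy
  refine mem_isolatedSeries_iff.2 ⟨a * b, mul_ne_zero ha hb, ?_⟩
  have := lie_mem_lowerCentralSeries hax hby
  rw [smul_lie, lie_smul, smul_smul] at this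
  rwa [show m + n - 1 = m - 1 + (n - 1) + 1 by omega]

theorem derivation_mem_lowerCentralSeries {D : M →ₗ[R] M}
    (hD : ∀ x y, D ⁅x, y⁆ = ⁅D x, y⁆ + ⁅x, D y⁆) {k : ℕ} {x : M}
    (hx : x ∈ LieModule.lowerCentralSeries R M M k) :
    D x ∈ LieModule.lowerCentralSeries R M M k := by
  induction k generalizing x with
  | zero => simp
  | succ k ih =>
    rw [LieModule.lowerCentralSeries_succ, ← LieSubmodule.mem_toSubmodule,
      LieSubmodule.lieIdeal_oper_eq_linear_span'] at hx
    have : Submodule.span R {m : M | ∃ x ∈ (⊤ : LieIdeal R M),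
        ∃ n ∈ LieModule.lowerCentralSeries R M M k, ⁅x, n⁆ = m} ≤
        (LieModule.lowerCentralSeries R M M (k + 1)).toSubmodule.comap D := by
      refine Submodule.span_le.2 ?_
      rintro _ ⟨z, -, n, hn, rfl⟩
      change D ⁅z, n⁆ ∈ LieModule.lowerCentralSeries R M M (k + 1)
      rw [hD, LieModule.lowerCentralSeries_succ]
      exact add_mem (LieSubmodule.lie_mem_lie (LieSubmodule.mem_top _) hn)
        (LieSubmodule.lie_mem_lie (LieSubmodule.mem_top _) (ih hn))
    exact this hx

theorem derivation_mem_isolatedSeries {D : M →ₗ[R] M}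
    (hD : ∀ x y, D ⁅x, y⁆ = ⁅D x, y⁆ + ⁅x, D y⁆) {m : ℕ} {x : M}
    (hx : x ∈ isolatedSeries R M m) : D x ∈ isolatedSeries R M m := by
  obtain ⟨a, ha, hax⟩ := mem_isolatedSeries_iff.1 hx
  refine mem_isolatedSeries_iff.2 ⟨a, ha, ?_⟩
  rw [← map_smul]
  exact derivation_mem_lowerCentralSeries hD hax

/-- Up to a nonzero scalar, elements of `M_{m+1}` are sums of brackets of `M` with `M_m`; hence an
equality between consecutive terms would propagate downwards. -/
theorem isolatedSeries_succ_le_succ {m n : ℕ} (hm : 1 ≤ m) (hn : 1 ≤ n)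
    (h : isolatedSeries R M m ≤ isolatedSeries R M n) :
    isolatedSeries R M (m + 1) ≤ isolatedSeries R M (n + 1) := by
  intro x hx
  obtain ⟨a, ha, hax⟩ := mem_isolatedSeries_iff.1 hx
  refine mem_isolatedSeries_of_smul ha ?_
  rw [show m + 1 - 1 = m - 1 + 1 by omega, LieModule.lowerCentralSeries_succ,
    ← LieSubmodule.mem_toSubmodule, LieSubmodule.lieIdeal_oper_eq_linear_span'] at hax
  refine (Submodule.span_le.2 ?_) hax
  rintro _ ⟨z, -, y, hy, rfl⟩
  rw [add_comm n 1]
  exact lie_mem_isolatedSeries le_rfl hn (by rw [isolatedSeries_eq_top le_rfl]; trivial)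
    (h (lowerCentralSeries_le_isolatedSeries m hy))

variable [LieRing.IsNilpotent M]

theorem lowerCentralSeries_nilpotencyClass :
    LieModule.lowerCentralSeries R M M (nilpotencyClass M) = ⊥ := by
  rcases h : nilpotencyClass M with _ | k
  · have := (LieModule.nilpotencyLength_eq_zero_iff (L := M) (M := M)).1 h
    exact Subsingleton.elim _ _
  · exact ((LieModule.nilpotencyLength_eq_succ_iff R M M k).1 h).1

theorem lowerCentralSeries_ne_bot {m : ℕ} (hm : m < nilpotencyClass M) :
    LieModule.lowerCentralSeries R M M m ≠ ⊥ := by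
  rcases h : nilpotencyClass M with _ | k
  · omega
  · intro h0
    refine ((LieModule.nilpotencyLength_eq_succ_iff R M M k).1 h).2 (eq_bot_iff.2 ?_)
    exact (LieModule.antitone_lowerCentralSeries R M M (by omega)).trans h0.le

theorem isolatedSeries_eq_bot [Module.IsTorsionFree R M] {m : ℕ} (hm : nilpotencyClass M < m) :
    isolatedSeries R M m = ⊥ := by
  rw [eq_bot_iff]
  intro x hx
  obtain ⟨a, ha, hax⟩ := mem_isolatedSeries_iff.1 hx
  have h := LieModule.antitone_lowerCentralSeries R M M (show nilpotencyClass M ≤ m - 1 by omega) hax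
  rw [lowerCentralSeries_nilpotencyClass, LieSubmodule.mem_bot] at h
  exact (smul_eq_zero.1 h).resolve_left ha

theorem not_isolatedSeries_le_succ [Module.IsTorsionFree R M] {m : ℕ} (hm : 1 ≤ m)
    (hmc : m ≤ nilpotencyClass M) :
    ¬ isolatedSeries R M m ≤ isolatedSeries R M (m + 1) := by
  intro h
  have key : ∀ k, isolatedSeries R M m ≤ isolatedSeries R M (m + k) := by
    intro k
    induction k with
    | zero => exact le_rfl
    | succ k ih => exact h.trans (isolatedSeries_succ_le_succ hm (by omega : 1 ≤ m + k) ih)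
  -- Far enough down the isolated series is zero, so `M_m` would vanish although the lower central
  -- series does not at that place.
  have h1 := key (nilpotencyClass M + 1)
  have hlt : nilpotencyClass M < m + (nilpotencyClass M + 1) := by omega
  rw [isolatedSeries_eq_bot hlt] at h1
  have h2 : m - 1 < nilpotencyClass M := by omega
  refine lowerCentralSeries_ne_bot (R := R) h2 ?_
  rw [← LieSubmodule.toSubmodule_eq_bot, eq_bot_iff]
  exact (lowerCentralSeries_le_isolatedSeries m).trans h1

end IsolatedSeries

/-! ### Bases adapted to a chain of pure submodules -/

section FlagBasis

variable {R : Type u} [CommRing R] [IsDomain R] [IsPrincipalIdealRing R]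
variable {V : Type v} [AddCommGroup V] [Module R V] [Module.Finite R V]

/-- The quotient is finitely generated and torsion-free over a principal ideal domain, hence
projective, and the projection splits. -/
theorem exists_isCompl_of_isTorsionFree (F : Submodule R V) [Module.IsTorsionFree R (V ⧸ F)] :
    ∃ C : Submodule R V, IsCompl F C := by
  obtain ⟨g, hg⟩ := Module.projective_lifting_property F.mkQ LinearMap.id F.mkQ_surjective
  have hg' : ∀ q, F.mkQ (g q) = q := fun q => DFunLike.congr_fun hg q
  refine ⟨LinearMap.range g, ?_, ?_⟩
  · rw [Submodule.disjoint_def]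
    rintro _ hx ⟨q, rfl⟩
    have : F.mkQ (g q) = 0 := (Submodule.Quotient.mk_eq_zero F).2 hx
    rw [hg'] at this
    rw [this, map_zero]
  · rw [codisjoint_iff, eq_top_iff]
    intro x _
    refine Submodule.mem_sup.2 ⟨x - g (F.mkQ x), ?_, g (F.mkQ x), ⟨_, rfl⟩, by abel⟩
    refine (Submodule.Quotient.mk_eq_zero F).1 ?_
    change F.mkQ (x - g (F.mkQ x)) = 0
    rw [map_sub, hg', sub_self]

/-- Built from the bottom of the chain: a family for `F (m + 1)` is continued by a basis of the
complement of `F (m + 1)` in `F m`, which the modular law provides as `C ⊓ F m`. -/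
theorem exists_flag_family [Module.Free R V] (F : ℕ → Submodule R V) (hF : Antitone F)
    (htf : ∀ m, Module.IsTorsionFree R (V ⧸ F m)) {N : ℕ} (hN : F N = ⊥) (d m : ℕ)
    (hm : N ≤ m + d) :
    ∃ (k : ℕ) (f : Fin k → V), LinearIndependent R f ∧ Submodule.span R (Set.range f) = F m ∧
      ∀ n, m ≤ n → ∃ j : ℕ, Submodule.span R (f '' {i | (i : ℕ) < j}) = F n := by
  induction d generalizing m with
  | zero =>
    have hbot : ∀ n, m ≤ n → F n = ⊥ := fun n hn => eq_bot_iff.2 ((hF (by omega)).trans hN.le)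
    exact ⟨0, Fin.elim0, linearIndependent_empty_type, by simp [hbot m le_rfl],
      fun n hn => ⟨0, by simp [hbot n hn]⟩⟩
  | succ d ih =>
    obtain ⟨k, f, hli, hspan, hf⟩ := ih (m + 1) (by omega)
    have := htf (m + 1)
    obtain ⟨C, hC⟩ := exists_isCompl_of_isTorsionFree (F (m + 1))
    have hle : F (m + 1) ≤ F m := hF (Nat.le_succ m)
    have hsup : F (m + 1) ⊔ (C ⊓ F m) = F m := by
      rw [← sup_inf_assoc_of_le C hle, hC.sup_eq_top, top_inf_eq]
    have hdisj : Disjoint (F (m + 1)) (C ⊓ F m) := hC.disjoint.mono_right inf_le_left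
    let B := Module.finBasis R (C ⊓ F m : Submodule R V)
    let g : Fin (Module.finrank R (C ⊓ F m : Submodule R V)) → V := fun i => (B i : V)
    have hg : LinearIndependent R g :=
      B.linearIndependent.map' (C ⊓ F m).subtype (Submodule.ker_subtype _)
    have hgspan : Submodule.span R (Set.range g) = C ⊓ F m := by
      have : Set.range g = (C ⊓ F m).subtype '' Set.range B := by
        rw [← Set.range_comp]; rfl
      rw [this, ← Submodule.map_span, B.span_eq, Submodule.map_top, Submodule.range_subtype]
    have happ : Fin.append f g = Sum.elim f g ∘ finSumFinEquiv.symm := by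
      ext i
      refine Fin.addCases (fun i => ?_) (fun i => ?_) i <;> simp
    have hrange : Set.range (Fin.append f g) = Set.range f ∪ Set.range g := by
      rw [happ, Set.range_comp, Equiv.range_eq_univ, Set.image_univ, Set.Sum.elim_range]
    have hspan' : Submodule.span R (Set.range (Fin.append f g)) = F m := by
      rw [hrange, Submodule.span_union, hspan, hgspan, hsup]
    refine ⟨_, Fin.append f g, ?_, hspan', fun n hn => ?_⟩
    · rw [happ]
      exact (hli.sum_type hg (by rwa [hspan, hgspan])).comp _ finSumFinEquiv.symm.injective
    · rcases hn.eq_or_lt with rfl | hn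
      · refine ⟨k + Module.finrank R (C ⊓ F m : Submodule R V), ?_⟩
        refine Eq.trans ?_ hspan'
        rw [← Set.image_univ]
        congr 2
        ext i
        simp
      · obtain ⟨j, hj⟩ := hf n hn
        -- `j` may exceed the length `k` of the old family; the minimum keeps the segment from
        -- reaching into the new vectors.
        refine ⟨min j k, ?_⟩
        rw [← hj]
        congr 1
        ext x
        constructor
        · rintro ⟨i, hi, rfl⟩
          rw [Set.mem_ofPred_eq, lt_min_iff] at hi
          refine ⟨⟨i, hi.2⟩, hi.1, ?_⟩
          conv_rhs => rw [show i = Fin.castAdd _ ⟨(i : ℕ), hi.2⟩ from rfl]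
          rw [Fin.append_left]
        · rintro ⟨i, hi, rfl⟩
          refine ⟨Fin.castAdd _ i, ?_, Fin.append_left f g i⟩
          rw [Set.mem_ofPred_eq, lt_min_iff]
          exact ⟨hi, i.2⟩

end FlagBasis

/-! ### Adapted bases and their weights -/

section Adapted

variable {R : Type u} [CommRing R] [IsDomain R]
variable {M : Type v} [LieRing M] [LieAlgebra R M]

instance isTorsionFree_quotient_isolatedSeries (m : ℕ) :
    Module.IsTorsionFree R (M ⧸ isolatedSeries R M m) := by
  refine Module.IsTorsionFree.of_smul_eq_zero fun a q h => ?_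
  induction q using Submodule.Quotient.induction_on with
  | H x =>
    rw [← Submodule.Quotient.mk_smul, Submodule.Quotient.mk_eq_zero] at h
    by_cases ha : a = 0
    · exact Or.inl ha
    · exact Or.inr ((Submodule.Quotient.mk_eq_zero _).2 (mem_isolatedSeries_of_smul ha h))

variable [LieRing.IsNilpotent M]

theorem exists_isAdapted [IsPrincipalIdealRing R] [Module.Free R M] [Module.Finite R M] {r : ℕ}
    (hr : r = Module.finrank R M) : ∃ b : Module.Basis (Fin r) R M, IsAdapted b := by
  obtain ⟨k, f, hli, hspan, hf⟩ := exists_flag_family (isolatedSeries R M)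
    isolatedSeries_antitone (fun m => inferInstance)
    (isolatedSeries_eq_bot (Nat.lt_succ_self (nilpotencyClass M))) (nilpotencyClass M) 1 (by omega)
  rw [isolatedSeries_eq_top le_rfl] at hspan
  let b := Module.Basis.mk hli hspan.ge
  have hk : k = r := by
    rw [hr, Module.finrank_eq_card_basis b, Fintype.card_fin]
  subst hk
  refine ⟨b, fun m hm => ?_⟩
  obtain ⟨j, hj⟩ := hf m hm
  exact ⟨j, by rw [← hj, Module.Basis.coe_mk]⟩

variable {r : ℕ} [Module.IsTorsionFree R M]

theorem mem_isolatedSeries_iff_le_elementWeight {x : M} (hx : x ≠ 0) {m : ℕ} :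
    x ∈ isolatedSeries R M m ↔ m ≤ elementWeight R x := by
  have hbdd : BddAbove {m : ℕ | x ∈ isolatedSeries R M m} := by
    refine ⟨nilpotencyClass M, fun m hm => ?_⟩
    by_contra! h
    rw [Set.mem_ofPred_eq, isolatedSeries_eq_bot h] at hm
    exact hx hm
  refine ⟨fun h => le_csSup hbdd h, fun h => isolatedSeries_antitone h ?_⟩
  exact Nat.sSup_mem ⟨0, by simp [isolatedSeries_eq_top]⟩ hbdd

theorem one_le_elementWeight {x : M} (hx : x ≠ 0) : 1 ≤ elementWeight R x :=
  (mem_isolatedSeries_iff_le_elementWeight hx).1 (by simp [isolatedSeries_eq_top])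

theorem elementWeight_le {x : M} (hx : x ≠ 0) : elementWeight R x ≤ nilpotencyClass M := by
  by_contra! h
  have := (mem_isolatedSeries_iff_le_elementWeight (R := R) hx).2 h
  rw [isolatedSeries_eq_bot (Nat.lt_succ_self _)] at this
  exact hx this

variable {b : Module.Basis (Fin r) R M}

theorem IsAdapted.isolatedSeries_eq (hb : IsAdapted b) (m : ℕ) :
    isolatedSeries R M m = Submodule.span R (b '' {i | m ≤ elementWeight R (b i)}) := by
  refine le_antisymm ?_ (Submodule.span_le.2 ?_)
  · rcases Nat.lt_or_ge m 1 with hm | hm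
    · have : {i | m ≤ elementWeight R (b i)} = Set.univ := by
        ext i; simp; omega
      rw [this, Set.image_univ, b.span_eq]
      exact le_top
    · obtain ⟨k, hk⟩ := hb m hm
      rw [← hk]
      refine Submodule.span_mono (Set.image_mono fun i hi => ?_)
      refine (mem_isolatedSeries_iff_le_elementWeight (b.ne_zero i)).1 ?_
      rw [← hk]
      exact Submodule.subset_span ⟨i, hi, rfl⟩
  · rintro _ ⟨i, hi, rfl⟩
    exact (mem_isolatedSeries_iff_le_elementWeight (b.ne_zero i)).2 hi

theorem IsAdapted.antitone_elementWeight (hb : IsAdapted b) :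
    Antitone fun i => elementWeight R (b i) := by
  intro i j hij
  obtain ⟨k, hk⟩ := hb _ (one_le_elementWeight (R := R) (b.ne_zero j))
  have hj := (mem_isolatedSeries_iff_le_elementWeight (R := R) (b.ne_zero j)).2 le_rfl
  rw [← hk, b.mem_span_image, b.repr_self] at hj
  have hjk : (j : ℕ) < k := hj (Finset.mem_coe.2 (Finsupp.mem_support_iff.2 (by simp)))
  refine (mem_isolatedSeries_iff_le_elementWeight (b.ne_zero i)).1 ?_
  rw [← hk]
  exact Submodule.subset_span ⟨i, lt_of_le_of_lt (Fin.le_def.1 hij) hjk, rfl⟩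

/-- A missing weight `m` would give `M_m = M_{m+1}`. The rank bound depends on this: repeated small
weights are the only freedom left. -/
theorem IsAdapted.exists_elementWeight_eq (hb : IsAdapted b) {m : ℕ} (hm : 1 ≤ m)
    (hmc : m ≤ nilpotencyClass M) : ∃ i, elementWeight R (b i) = m := by
  by_contra! h
  refine not_isolatedSeries_le_succ (R := R) hm hmc ?_
  rw [hb.isolatedSeries_eq, hb.isolatedSeries_eq]
  refine Submodule.span_mono (Set.image_mono fun i hi => ?_)
  exact lt_of_le_of_ne hi (h i).symm

theorem IsAdapted.lie_mem_span (hb : IsAdapted b) (i j : Fin r) :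
    ⁅b i, b j⁆ ∈ Submodule.span R
      (b '' {l | elementWeight R (b i) + elementWeight R (b j) ≤ elementWeight R (b l)}) := by
  rw [← hb.isolatedSeries_eq]
  exact lie_mem_isolatedSeries (one_le_elementWeight (b.ne_zero i))
    (one_le_elementWeight (b.ne_zero j))
    ((mem_isolatedSeries_iff_le_elementWeight (b.ne_zero i)).2 le_rfl)
    ((mem_isolatedSeries_iff_le_elementWeight (b.ne_zero j)).2 le_rfl)

/-- A bracket with `b i` has weight strictly above that of `b i`, and weights decrease along the
basis. This is the flag of ideals required for the independence of monomials. -/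
theorem IsAdapted.lie_mem_span_lt (hb : IsAdapted b) (i j : Fin r) :
    ⁅b i, b j⁆ ∈ Submodule.span R (b '' {l | l < i}) := by
  refine Submodule.span_mono (Set.image_mono fun l hl => ?_) (hb.lie_mem_span i j)
  have hj := one_le_elementWeight (R := R) (b.ne_zero j)
  by_contra h
  have := hb.antitone_elementWeight (not_lt.1 h)
  simp only [Set.mem_ofPred_eq] at hl this
  omega

theorem IsAdapted.derivation_mem_span (hb : IsAdapted b) {D : M →ₗ[R] M}
    (hD : ∀ x y, D ⁅x, y⁆ = ⁅D x, y⁆ + ⁅x, D y⁆) (i : Fin r) :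
    D (b i) ∈ Submodule.span R (b '' {l | elementWeight R (b i) ≤ elementWeight R (b l)}) := by
  rw [← hb.isolatedSeries_eq]
  exact derivation_mem_isolatedSeries hD
    ((mem_isolatedSeries_iff_le_elementWeight (b.ne_zero i)).2 le_rfl)

theorem weightSubmodule_eq_weightFiltration (b : Module.Basis (Fin r) R M) (m : ℕ) :
    weightSubmodule b m = weightFiltration b (fun i => elementWeight R (b i)) (m + 1) := by
  ext u
  rw [weightFiltration, Finsupp.mem_span_image_iff_linearCombination]
  change (m : ℕ∞) < weight b u ↔ _
  rw [lt_weight_iff]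
  constructor
  · rintro ⟨d, hd, h⟩
    exact ⟨d, fun α hα => h α hα, hd⟩
  · rintro ⟨d, h, hd⟩
    exact ⟨d, hd, fun α hα => h hα⟩

theorem IsAdapted.weightSubmodule_eq_span (hb : IsAdapted b) (m : ℕ) :
    weightSubmodule b m = Submodule.span R (monomialBasis b (fun i => elementWeight R (b i))
      hb.lie_mem_span hb.lie_mem_span_lt '' {α | m < monomialWeight b α}) := by
  rw [weightSubmodule_eq_weightFiltration, weightFiltration]
  congr 2
  exact (Module.Basis.coe_mk _ _).symm

/-- The quotient `U / U^m` has the basis of the ordered monomials of weight at most `m`. -/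
def IsAdapted.truncationEquiv (hb : IsAdapted b) (m : ℕ) :
    truncation b m ≃ₗ[R] ({α | m < monomialWeight b α}ᶜ : Set (Fin r → ℕ)) →₀ R :=
  (Submodule.quotEquivOfEq _ _ (hb.weightSubmodule_eq_span m)).trans
    (quotientSpanEquiv (monomialBasis b (fun i => elementWeight R (b i))
      hb.lie_mem_span hb.lie_mem_span_lt) _)

end Adapted

/-! ### Numerical estimates: Euler product, Wallis, scaled binomials -/

section Constants

/-- The partial product `∏_{l=2}^{k+1} 2^l / (2^l - 1)`. -/
def eulerPartial (k : ℕ) : ℝ := ∏ j ∈ Finset.range k, (2 : ℝ) ^ (j + 2) / (2 ^ (j + 2) - 1)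

theorem one_lt_two_pow_succ (j : ℕ) : (1 : ℝ) < 2 ^ (j + 1) :=
  one_lt_pow₀ one_lt_two (Nat.succ_ne_zero j)

theorem one_le_euler_factor (j : ℕ) : (1 : ℝ) ≤ 2 ^ (j + 1) / (2 ^ (j + 1) - 1) := by
  have := one_lt_two_pow_succ j
  rw [le_div_iff₀ (by linarith)]
  linarith

theorem one_le_eulerPartial (k : ℕ) : 1 ≤ eulerPartial k := by
  unfold eulerPartial
  induction k with
  | zero => simp
  | succ k ih =>
    rw [Finset.prod_range_succ]
    exact one_le_mul_of_one_le_of_one_le ih (one_le_euler_factor (k + 1))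

/-- The inequality `∏ (1 - 2^(-l)) ≥ 1 - ∑ 2^(-l)` for `2 ≤ l ≤ k + 1`. Unlike the bound by `2` that
follows from it, it can be proved by induction. -/
theorem eulerPartial_mul_le_one (k : ℕ) : eulerPartial k * (1 / 2 + (1 / 2) ^ (k + 1)) ≤ 1 := by
  induction k with
  | zero => norm_num [eulerPartial]
  | succ k ih =>
    have h0 : 0 ≤ eulerPartial k := zero_le_one.trans (one_le_eulerPartial k)
    have h1 := one_lt_two_pow_succ (k + 1)
    have hx : (1 / 2 : ℝ) ^ (k + 1) ≤ 1 / 2 := by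
      calc (1 / 2 : ℝ) ^ (k + 1) ≤ (1 / 2) ^ 1 :=
            pow_le_pow_of_le_one (by norm_num) (by norm_num) (by omega)
        _ = 1 / 2 := pow_one _
    have hx0 : (0 : ℝ) < (1 / 2) ^ (k + 1) := by positivity
    have hf : (2 : ℝ) ^ (k + 2) / (2 ^ (k + 2) - 1) = 1 / (1 - (1 / 2) ^ (k + 1) / 2) := by
      have h2 : (2 : ℝ) ^ (k + 2) = 2 / (1 / 2) ^ (k + 1) := by
        rw [one_div, inv_pow, div_inv_eq_mul]; ring
      rw [h2]
      field_simp
    have hrec : eulerPartial (k + 1) = eulerPartial k * (1 / (1 - (1 / 2) ^ (k + 1) / 2)) := by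
      rw [eulerPartial, Finset.prod_range_succ, hf]; rfl
    rw [hrec, pow_succ (1 / 2 : ℝ) (k + 1)]
    set x : ℝ := (1 / 2) ^ (k + 1)
    refine le_trans ?_ ih
    rw [mul_assoc]
    refine mul_le_mul_of_nonneg_left ?_ h0
    rw [div_mul_eq_mul_div, one_mul, div_le_iff₀ (by linarith)]
    nlinarith

theorem eulerPartial_le_two (k : ℕ) : eulerPartial k ≤ 2 := by
  have h := eulerPartial_mul_le_one k
  have h0 : 0 ≤ eulerPartial k := zero_le_one.trans (one_le_eulerPartial k)
  have hx0 : (0 : ℝ) < (1 / 2) ^ (k + 1) := by positivity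
  nlinarith [mul_nonneg h0 hx0.le]

theorem sum_div_two_pow_sub_one_le (k : ℕ) :
    ∑ j ∈ Finset.range k, ((j : ℝ) + 2) / (2 ^ (j + 2) - 1) ≤ 2 := by
  -- Since `2^l ≥ 4`, each term is at most `4/3 · l/2^l`. The full sum of `l/2^l` over `l ≥ 2` is
  -- `3/2`, and its tail from `k + 2` on is `(k + 3)/2^(k+1)`.
  suffices h : ∑ j ∈ Finset.range k, ((j : ℝ) + 2) / (2 ^ (j + 2) - 1) ≤
      2 - 4 / 3 * ((k + 3) / 2 ^ (k + 1)) by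
    have : (0 : ℝ) ≤ 4 / 3 * ((k + 3) / 2 ^ (k + 1)) := by positivity
    linarith
  induction k with
  | zero => norm_num
  | succ k ih =>
    rw [Finset.sum_range_succ]
    have h4 : (4 : ℝ) ≤ 2 ^ (k + 2) := by
      rw [pow_add]
      have : (1 : ℝ) ≤ 2 ^ k := one_le_pow₀ one_le_two
      linarith
    have h1 : ((k : ℝ) + 2) / (2 ^ (k + 2) - 1) ≤ 4 / 3 * ((k + 2) / 2 ^ (k + 2)) := by
      rw [← mul_div_assoc, div_le_div_iff₀ (by linarith) (by linarith)]
      nlinarith [(Nat.cast_nonneg k : (0 : ℝ) ≤ k)]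
    have h2 : ((k : ℝ) + 3) / 2 ^ (k + 1) = 2 * (k + 3) / 2 ^ (k + 2) := by
      rw [pow_succ (2 : ℝ) (k + 1)]
      field_simp
    have h3 : (((k + 1 : ℕ) : ℝ) + 3) / 2 ^ (k + 1 + 1) = (k + 4) / 2 ^ (k + 2) := by
      push_cast; ring
    rw [h3]
    rw [h2] at ih
    have h5 : 2 * ((k : ℝ) + 3) / 2 ^ (k + 2) = (k + 4) / 2 ^ (k + 2) + (k + 2) / 2 ^ (k + 2) := by
      ring
    linarith

theorem two_mul_eulerPartial_le_eta (k : ℕ) :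
    Real.sqrt (2 / Real.pi) * (2 * eulerPartial k) ≤ eta := by
  refine mul_le_mul_of_nonneg_left ?_ (Real.sqrt_nonneg _)
  have hs : Summable fun l : ℕ => 1 / ((2 : ℝ) ^ (l + 1) - 1) := by
    refine Summable.of_nonneg_of_le (fun l => ?_) (fun l => ?_) summable_geometric_two
    · have := one_lt_two_pow_succ l
      exact one_div_nonneg.2 (by linarith)
    · rw [one_div_pow]
      refine one_div_le_one_div_of_le (by positivity) ?_
      have : (1 : ℝ) ≤ 2 ^ l := one_le_pow₀ one_le_two
      rw [pow_succ]; linarith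
  have hm : Multipliable fun l : ℕ => (2 : ℝ) ^ (l + 1) / (2 ^ (l + 1) - 1) := by
    refine (Real.multipliable_one_add_of_summable hs).congr fun l => ?_
    have := one_lt_two_pow_succ l
    have h : (2 : ℝ) ^ (l + 1) - 1 ≠ 0 := by linarith
    field_simp
    ring
  have hmono : Monotone fun n => ∏ l ∈ Finset.range n, (2 : ℝ) ^ (l + 1) / (2 ^ (l + 1) - 1) := by
    refine monotone_nat_of_le_succ fun n => ?_
    rw [Finset.prod_range_succ]
    refine le_mul_of_one_le_right (Finset.prod_nonneg fun l _ => ?_) (one_le_euler_factor n)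
    exact zero_le_one.trans (one_le_euler_factor l)
  have h := hmono.ge_of_tendsto hm.tendsto_prod_tprod_nat (k + 1)
  rw [Finset.prod_range_succ'] at h
  refine le_trans (le_of_eq ?_) h
  rw [eulerPartial, mul_comm]
  norm_num

/-- `C(2d, d) / 4^d`. -/
def centralRatio (d : ℕ) : ℝ := d.centralBinom / 4 ^ d

theorem centralRatio_pos (d : ℕ) : 0 < centralRatio d :=
  div_pos (by exact_mod_cast d.centralBinom_pos) (by positivity)

theorem centralRatio_succ (d : ℕ) :
    centralRatio (d + 1) = centralRatio d * ((2 * d + 1) / (2 * d + 2)) := by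
  have h : ((d : ℝ) + 1) * (d + 1).centralBinom = 2 * (2 * d + 1) * d.centralBinom := by
    exact_mod_cast Nat.succ_mul_centralBinom_succ d
  have hd : (d : ℝ) + 1 ≠ 0 := by positivity
  have h' : ((d + 1).centralBinom : ℝ) = 2 * (2 * d + 1) * d.centralBinom / (d + 1) := by
    rw [eq_div_iff hd, ← h]; ring
  rw [centralRatio, centralRatio, h', pow_succ]
  field_simp
  ring

theorem centralRatio_sq_mul_W (d : ℕ) :
    centralRatio d ^ 2 * (2 * d + 1) * Real.Wallis.W d = 1 := by
  induction d with
  | zero => simp [centralRatio, Real.Wallis.W]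
  | succ d ih =>
    rw [centralRatio_succ, Real.Wallis.W_succ]
    push_cast
    have h1 : (2 * (d : ℝ) + 1) ≠ 0 := by positivity
    have h2 : (2 * (d : ℝ) + 2) ≠ 0 := by positivity
    have h3 : (2 * (d : ℝ) + 3) ≠ 0 := by positivity
    refine Eq.trans ?_ ih
    field_simp
    ring

/-- The left side increases with `d`, and by Wallis' product it tends to `1/π`. The shift `1/4`
still allows monotonicity and supplies the `1/2` in the later condition on `θ`. -/
theorem centralRatio_sq_le (d : ℕ) : centralRatio d ^ 2 * (d + 1 / 4) ≤ 1 / Real.pi := by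
  have hmono : Monotone fun d : ℕ => centralRatio d ^ 2 * ((d : ℝ) + 1 / 4) := by
    refine monotone_nat_of_le_succ fun d => ?_
    rw [centralRatio_succ, mul_pow, mul_assoc]
    refine mul_le_mul_of_nonneg_left ?_ (sq_nonneg _)
    push_cast
    rw [div_pow, div_mul_eq_mul_div, le_div_iff₀ (by positivity)]
    nlinarith [(Nat.cast_nonneg d : (0 : ℝ) ≤ d)]
  have hW : ∀ d : ℕ, centralRatio d ^ 2 * ((d : ℝ) + 1 / 4) =
      (1 / 2 - 1 / 4 * (1 / (2 * d + 1))) * (Real.Wallis.W d)⁻¹ := by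
    intro d
    have h1 : (2 * (d : ℝ) + 1) ≠ 0 := by positivity
    have h2 := (Real.Wallis.W_pos d).ne'
    have h3 := centralRatio_sq_mul_W d
    have h4 : centralRatio d ^ 2 = (2 * (d : ℝ) + 1)⁻¹ * (Real.Wallis.W d)⁻¹ := by
      rw [← mul_inv]
      exact eq_inv_of_mul_eq_one_left (by rw [← mul_assoc, h3])
    rw [h4]
    field_simp
    ring
  have h0 : Filter.Tendsto (fun d : ℕ => 1 / (2 * (d : ℝ) + 1)) Filter.atTop (nhds 0) := by
    have h := tendsto_one_div_add_atTop_nhds_zero_nat (𝕜 := ℝ)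
    refine squeeze_zero (fun d => by positivity) (fun d => ?_) h
    exact one_div_le_one_div_of_le (by positivity) (by linarith [(Nat.cast_nonneg d : (0 : ℝ) ≤ d)])
  have hlim : Filter.Tendsto (fun d : ℕ => centralRatio d ^ 2 * ((d : ℝ) + 1 / 4)) Filter.atTop
      (nhds ((1 / 2 - 1 / 4 * 0) * (Real.pi / 2)⁻¹)) := by
    simp only [hW]
    exact (tendsto_const_nhds.sub (tendsto_const_nhds.mul h0)).mul
      (Real.Wallis.tendsto_W_nhds_pi_div_two.inv₀ (by positivity))
  refine (hmono.ge_of_tendsto hlim d).trans (le_of_eq ?_)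
  have := Real.pi_pos.ne'
  field_simp
  ring

/-- `C(n + d, d) / 2^n`. -/
def scaledChoose (d n : ℕ) : ℝ := ((n + d).choose d : ℝ) / 2 ^ n

theorem scaledChoose_nonneg (d n : ℕ) : 0 ≤ scaledChoose d n := by
  unfold scaledChoose; positivity

theorem scaledChoose_succ (d n : ℕ) :
    scaledChoose d (n + 1) = scaledChoose d n * ((n + 1 + d) / (2 * (n + 1))) := by
  have h : ((n + d).choose d : ℝ) * (n + d + 1) = (n + 1 + d).choose d * (n + 1) := by
    have := Nat.choose_mul_succ_eq (n + d) d
    rw [show n + d + 1 - d = n + 1 by omega, show n + d + 1 = n + 1 + d by omega] at this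
    have h' : (((n + d).choose d * (n + 1 + d) : ℕ) : ℝ) =
      (((n + 1 + d).choose d * (n + 1) : ℕ) : ℝ) := by rw [this]
    push_cast at h'
    linarith
  have h1 : (n : ℝ) + 1 ≠ 0 := by positivity
  have h2 : ((n + 1 + d).choose d : ℝ) = (n + d).choose d * (n + d + 1) / (n + 1) := by
    rw [eq_div_iff h1, h]
  rw [scaledChoose, scaledChoose, h2, pow_succ]
  field_simp
  ring

theorem scaledChoose_succ_le {d n : ℕ} (h : d ≤ n + 1) :
    scaledChoose d (n + 1) ≤ scaledChoose d n := by
  rw [scaledChoose_succ]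
  refine mul_le_of_le_one_right (scaledChoose_nonneg d n) ?_
  rw [div_le_one (by positivity)]
  have : (d : ℝ) ≤ n + 1 := by exact_mod_cast h
  linarith

theorem scaledChoose_le_succ {d n : ℕ} (h : n + 1 ≤ d) :
    scaledChoose d n ≤ scaledChoose d (n + 1) := by
  rw [scaledChoose_succ]
  refine le_mul_of_one_le_right (scaledChoose_nonneg d n) ?_
  rw [one_le_div (by positivity)]
  have : (n + 1 : ℝ) ≤ d := by exact_mod_cast h
  linarith

theorem scaledChoose_self (d : ℕ) : scaledChoose d d = 2 ^ d * centralRatio d := by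
  rw [scaledChoose, centralRatio, Nat.centralBinom, two_mul,
    show (4 : ℝ) ^ d = 2 ^ d * 2 ^ d by rw [← mul_pow]; norm_num]
  field_simp

/-- The ratio of consecutive terms is `(n + 1 + d)/(2(n + 1))`, which passes `1` at `n + 1 = d`. -/
theorem scaledChoose_le_self (d n : ℕ) : scaledChoose d n ≤ scaledChoose d d := by
  rcases le_total d n with h | h
  · induction n, h using Nat.le_induction with
    | base => exact le_rfl
    | succ n hn ih => exact (scaledChoose_succ_le (by omega)).trans ih
  · induction h using Nat.decreasingInduction with
    | self => exact le_rfl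
    | of_succ n hn ih => exact (scaledChoose_le_succ hn).trans ih

theorem scaledChoose_add_two_le {d n : ℕ} (h : d + 2 ≤ n) :
    scaledChoose d n ≤ scaledChoose d d * ((2 * d + 1) / (2 * (d + 2))) := by
  induction n, h using Nat.le_induction with
  | base =>
    rw [scaledChoose_succ, scaledChoose_succ, mul_assoc]
    refine mul_le_mul_of_nonneg_left (le_of_eq ?_) (scaledChoose_nonneg d d)
    push_cast
    field_simp
    ring
  | succ n hn ih => exact (scaledChoose_succ_le (by omega)).trans ih

theorem scaledChoose_add_four_le {d n : ℕ} (h : d + 4 ≤ n) : scaledChoose d n ≤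
    scaledChoose d d * ((2 * d + 1) * (2 * d + 3) / (4 * (d + 3) * (d + 4))) := by
  induction n, h using Nat.le_induction with
  | base =>
    rw [scaledChoose_succ, scaledChoose_succ, scaledChoose_succ, scaledChoose_succ, mul_assoc,
      mul_assoc, mul_assoc]
    refine mul_le_mul_of_nonneg_left (le_of_eq ?_) (scaledChoose_nonneg d d)
    push_cast
    field_simp
    ring
  | succ n hn ih => exact (scaledChoose_succ_le (by omega)).trans ih

end Constants

/-! ### Coefficient bounds at the point `1/2` -/

section PowerSeries

open PowerSeries

/-- The power series `1 / (1 - X^w)`. -/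
def geomSeries (w : ℕ) : PowerSeries ℝ := mk fun n => if w ∣ n then 1 else 0

/-- The partial sums of the coefficients of a power series, scaled by powers of `1/2`. -/
def scaledSum (A : PowerSeries ℝ) (N : ℕ) : ℝ := ∑ j ∈ Finset.range N, coeff j A / 2 ^ j

theorem coeff_geomSeries_nonneg (w n : ℕ) : 0 ≤ coeff n (geomSeries w) := by
  rw [geomSeries, coeff_mk]
  split_ifs <;> norm_num

theorem coeff_geomSeries_le (w n : ℕ) : coeff n (geomSeries w) ≤ coeff n (geomSeries 1) := by
  rw [geomSeries, geomSeries, coeff_mk, coeff_mk, if_pos (one_dvd n)]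
  split_ifs <;> norm_num

theorem geomSeries_eq {w : ℕ} (hw : 1 ≤ w) : geomSeries w = 1 + X ^ w * geomSeries w := by
  ext n
  rw [map_add, coeff_X_pow_mul', geomSeries, coeff_mk, coeff_mk, coeff_one]
  rcases Nat.eq_zero_or_pos n with rfl | hn
  · simp [show ¬ w ≤ 0 by omega]
  · rw [if_neg hn.ne', zero_add]
    by_cases h : w ≤ n
    · rw [if_pos h]
      congr 1
      rw [eq_iff_iff]
      exact ⟨fun h' => Nat.dvd_sub h' dvd_rfl, fun h' => by
        simpa [Nat.sub_add_cancel h] using dvd_add h' (dvd_refl w)⟩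
    · rw [if_neg h, if_neg fun h' => h (Nat.le_of_dvd hn h')]

theorem coeff_mul_nonneg {A B : PowerSeries ℝ} (hA : ∀ n, 0 ≤ coeff n A)
    (hB : ∀ n, 0 ≤ coeff n B) (n : ℕ) : 0 ≤ coeff n (A * B) := by
  rw [coeff_mul]
  exact Finset.sum_nonneg fun p _ => mul_nonneg (hA _) (hB _)

theorem coeff_mul_le_mul {A A' B B' : PowerSeries ℝ} (hA : ∀ n, 0 ≤ coeff n A)
    (hAA : ∀ n, coeff n A ≤ coeff n A') (hB : ∀ n, 0 ≤ coeff n B)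
    (hBB : ∀ n, coeff n B ≤ coeff n B') (n : ℕ) : coeff n (A * B) ≤ coeff n (A' * B') := by
  rw [coeff_mul, coeff_mul]
  exact Finset.sum_le_sum fun p _ =>
    mul_le_mul (hAA _) (hBB _) (hB _) ((hA _).trans (hAA _))

theorem coeff_prod_nonneg {ι : Type*} (s : Finset ι) {f : ι → PowerSeries ℝ}
    (hf : ∀ i n, 0 ≤ coeff n (f i)) (n : ℕ) : 0 ≤ coeff n (∏ i ∈ s, f i) := by
  classical
  rw [coeff_prod]
  exact Finset.sum_nonneg fun l _ => Finset.prod_nonneg fun i _ => hf i _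

theorem coeff_prod_le_prod {ι : Type*} (s : Finset ι) {f g : ι → PowerSeries ℝ}
    (hf : ∀ i n, 0 ≤ coeff n (f i)) (hfg : ∀ i n, coeff n (f i) ≤ coeff n (g i)) (n : ℕ) :
    coeff n (∏ i ∈ s, f i) ≤ coeff n (∏ i ∈ s, g i) := by
  classical
  rw [coeff_prod, coeff_prod]
  exact Finset.sum_le_sum fun l _ => Finset.prod_le_prod (fun i _ => hf i _) fun i _ => hfg i _

theorem scaledSum_mono {A : PowerSeries ℝ} (hA : ∀ n, 0 ≤ coeff n A) : Monotone (scaledSum A) :=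
  monotone_nat_of_le_succ fun n => by
    rw [scaledSum, scaledSum, Finset.sum_range_succ]
    have := hA n
    have : 0 ≤ coeff n A / 2 ^ n := by positivity
    linarith

theorem scaledSum_add (A B : PowerSeries ℝ) (N : ℕ) :
    scaledSum (A + B) N = scaledSum A N + scaledSum B N := by
  simp only [scaledSum, map_add, add_div, Finset.sum_add_distrib]

theorem scaledSum_smul (a : ℝ) (A : PowerSeries ℝ) (N : ℕ) :
    scaledSum (a • A) N = a * scaledSum A N := by
  simp only [scaledSum, coeff_smul, smul_eq_mul, Finset.mul_sum, mul_div_assoc]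

theorem scaledSum_sum {ι : Type*} (s : Finset ι) (f : ι → PowerSeries ℝ) (N : ℕ) :
    scaledSum (∑ i ∈ s, f i) N = ∑ i ∈ s, scaledSum (f i) N := by
  simp only [scaledSum, map_sum, Finset.sum_div]
  exact Finset.sum_comm

theorem scaledSum_X_pow_mul_le {A : PowerSeries ℝ} (hA : ∀ n, 0 ≤ coeff n A) (w N : ℕ) :
    scaledSum (X ^ w * A) N ≤ scaledSum A N / 2 ^ w := by
  have hX : ∀ n, 0 ≤ coeff n (X ^ w * A) := fun n => by
    rw [coeff_X_pow_mul']
    split_ifs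
    exacts [hA _, le_rfl]
  refine (scaledSum_mono hX (Nat.le_add_left N w)).trans (le_of_eq ?_)
  have h0 : ∑ j ∈ Finset.range w, coeff j (X ^ w * A) / 2 ^ j = 0 := by
    refine Finset.sum_eq_zero fun j hj => ?_
    rw [coeff_X_pow_mul', if_neg (not_le.2 (Finset.mem_range.1 hj)), zero_div]
  rw [scaledSum, scaledSum, Finset.sum_range_add, h0, zero_add, Finset.sum_div]
  refine Finset.sum_congr rfl fun j _ => ?_
  rw [add_comm w j, coeff_X_pow_mul, pow_add, div_div]

theorem scaledSum_geomSeries_mul_le {A : PowerSeries ℝ} (hA : ∀ n, 0 ≤ coeff n A) {B : ℝ}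
    (hB : ∀ N, scaledSum A N ≤ B) (w N : ℕ) :
    scaledSum (geomSeries (w + 1) * A) N ≤ B * (2 ^ (w + 1) / (2 ^ (w + 1) - 1)) := by
  have hg := coeff_mul_nonneg (coeff_geomSeries_nonneg (w + 1)) hA
  have h1 : geomSeries (w + 1) * A = A + X ^ (w + 1) * (geomSeries (w + 1) * A) := by
    linear_combination A * geomSeries_eq (show 1 ≤ w + 1 by omega)
  have h2 := scaledSum_X_pow_mul_le hg (w + 1) N
  have h3 : scaledSum (geomSeries (w + 1) * A) N =
      scaledSum A N + scaledSum (X ^ (w + 1) * (geomSeries (w + 1) * A)) N := by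
    rw [← scaledSum_add, ← h1]
  have h4 := one_lt_two_pow_succ w
  rw [← mul_div_assoc, le_div_iff₀ (by linarith)]
  -- With `S` the partial sum, `g A = A + X^(w+1) g A` gives `S ≤ B + S/2^(w+1)`, which is solved
  -- for `S`. Finite sums make any discussion of convergence unnecessary.
  have h5 : scaledSum (geomSeries (w + 1) * A) N ≤
      B + scaledSum (geomSeries (w + 1) * A) N / 2 ^ (w + 1) := by
    linarith [hB N]
  have h6 : scaledSum (geomSeries (w + 1) * A) N / 2 ^ (w + 1) * 2 ^ (w + 1) =
      scaledSum (geomSeries (w + 1) * A) N := by field_simp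
  nlinarith [mul_le_mul_of_nonneg_right h5 (show (0 : ℝ) ≤ 2 ^ (w + 1) by positivity)]

theorem scaledSum_one_le (N : ℕ) : scaledSum 1 N ≤ 1 := by
  refine (scaledSum_mono (fun n => ?_) (Nat.le_succ N)).trans (le_of_eq ?_)
  · rw [coeff_one]; split_ifs <;> norm_num
  · rw [scaledSum, Finset.sum_range_succ']
    simp [coeff_one]

/-- The product `∏_{l=2}^{k+1} 1 / (1 - X^l)`. -/
def geomProd (k : ℕ) : PowerSeries ℝ := ∏ j ∈ Finset.range k, geomSeries (j + 2)

theorem coeff_geomProd_nonneg (k n : ℕ) : 0 ≤ coeff n (geomProd k) :=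
  coeff_prod_nonneg _ (fun _ _ => coeff_geomSeries_nonneg _ _) n

theorem scaledSum_geomProd_le (k N : ℕ) : scaledSum (geomProd k) N ≤ eulerPartial k := by
  induction k generalizing N with
  | zero => simpa [geomProd, eulerPartial] using scaledSum_one_le N
  | succ k ih =>
    rw [geomProd, Finset.prod_range_succ, mul_comm, eulerPartial, Finset.prod_range_succ]
    exact scaledSum_geomSeries_mul_le (coeff_geomProd_nonneg k) ih (k + 1) N

theorem coeff_zero_geomProd (k : ℕ) : coeff 0 (geomProd k) = 1 := by
  rw [geomProd, coeff_zero_eq_constantCoeff_apply, map_prod]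
  refine Finset.prod_eq_one fun j _ => ?_
  rw [← coeff_zero_eq_constantCoeff_apply, geomSeries, coeff_mk, if_pos (dvd_zero _)]

theorem coeff_geomSeries_one_pow (d n : ℕ) :
    coeff n (geomSeries 1 ^ (d + 1)) = (n + d).choose d := by
  have h : geomSeries 1 = mk 1 := by
    ext n
    simp [geomSeries]
  rw [h, mk_one_pow_eq_mk_choose_add, coeff_mk, add_comm]

theorem coeff_mul_div_eq (A H : PowerSeries ℝ) (n : ℕ) : coeff n (A * H) / 2 ^ n =
    ∑ j ∈ Finset.range (n + 1), coeff j A / 2 ^ j * (coeff (n - j) H / 2 ^ (n - j)) := by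
  rw [coeff_mul, Finset.Nat.sum_antidiagonal_eq_sum_range_succ_mk, Finset.sum_div]
  refine Finset.sum_congr rfl fun j hj => ?_
  have h : (2 : ℝ) ^ n = 2 ^ j * 2 ^ (n - j) := by
    rw [← pow_add, Nat.add_sub_cancel' (Nat.lt_succ_iff.1 (Finset.mem_range.1 hj))]
  rw [h, mul_div_mul_comm]

theorem coeff_mul_div_le {A H : PowerSeries ℝ} (hA : ∀ n, 0 ≤ coeff n A) {K : ℝ}
    (hK : ∀ n, coeff n H / 2 ^ n ≤ K) (n : ℕ) :
    coeff n (A * H) / 2 ^ n ≤ K * scaledSum A (n + 1) := by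
  rw [coeff_mul_div_eq, scaledSum, Finset.mul_sum]
  refine Finset.sum_le_sum fun j _ => ?_
  rw [mul_comm K]
  exact mul_le_mul_of_nonneg_left (hK _) (div_nonneg (hA j) (by positivity))

/-- The constant term of `A` meets exactly the top coefficient of `H`, which may be much smaller
than the uniform bound `K`; only the other terms are estimated by `K`. -/
theorem coeff_mul_div_le_add {A H : PowerSeries ℝ} (hA : ∀ n, 0 ≤ coeff n A)
    (hA0 : coeff 0 A = 1) {K : ℝ} (hK : ∀ n, coeff n H / 2 ^ n ≤ K) (n : ℕ) :
    coeff n (A * H) / 2 ^ n ≤ coeff n H / 2 ^ n + K * (scaledSum A (n + 1) - 1) := by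
  rw [coeff_mul_div_eq, scaledSum, Finset.sum_range_succ', Finset.sum_range_succ', hA0]
  simp only [pow_zero, div_one, add_sub_cancel_right, Nat.sub_zero, one_mul]
  rw [add_comm, Finset.mul_sum]
  refine add_le_add le_rfl (Finset.sum_le_sum fun j _ => ?_)
  rw [mul_comm K]
  exact mul_le_mul_of_nonneg_left (hK _) (div_nonneg (hA _) (by positivity))

/-- Logarithmic derivatives are kept in the form `X A' = A p`; products of series then add the
factors `p`. -/
theorem X_mul_derivative_geomSeries {w : ℕ} (hw : 1 ≤ w) : X * derivative ℝ (geomSeries w) =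
    geomSeries w * ((w : ℝ) • (X ^ w * geomSeries w)) := by
  obtain ⟨v, rfl⟩ : ∃ v, w = v + 1 := ⟨w - 1, by omega⟩
  have h := geomSeries_eq hw
  have h1 := congrArg (derivative ℝ) h
  rw [map_add, derivative_one, zero_add, Derivation.leibniz, derivative_pow, derivative_X,
    mul_one, smul_eq_mul, smul_eq_mul, Nat.add_sub_cancel] at h1
  set g := geomSeries (v + 1)
  set D := derivative ℝ g
  have h2 : ((v + 1 : ℕ) : PowerSeries ℝ) = C ((v + 1 : ℕ) : ℝ) := by simp
  rw [h2] at h1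
  rw [smul_eq_C_mul]
  set a : PowerSeries ℝ := C ((v + 1 : ℕ) : ℝ)
  have h3 : g * (1 - X ^ (v + 1)) = 1 := by linear_combination h
  have h4 : D * (1 - X ^ (v + 1)) = g * (a * X ^ v) := by linear_combination h1
  calc X * D = X * D * (g * (1 - X ^ (v + 1))) := by rw [h3, mul_one]
    _ = X * g * (D * (1 - X ^ (v + 1))) := by ring
    _ = g * (a * (X ^ (v + 1) * g)) := by rw [h4]; ring

theorem X_mul_derivative_mul {A B p q : PowerSeries ℝ} (hA : X * derivative ℝ A = A * p)
    (hB : X * derivative ℝ B = B * q) : X * derivative ℝ (A * B) = A * B * (p + q) := by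
  rw [Derivation.leibniz, smul_eq_mul, smul_eq_mul]
  linear_combination B * hA + A * hB

theorem X_mul_derivative_pow {A p : PowerSeries ℝ} (hA : X * derivative ℝ A = A * p) (n : ℕ) :
    X * derivative ℝ (A ^ n) = A ^ n * ((n : ℝ) • p) := by
  induction n with
  | zero => simp
  | succ n ih =>
    rw [pow_succ, X_mul_derivative_mul ih hA]
    push_cast
    rw [add_smul, one_smul]

theorem X_mul_derivative_geomProd (k : ℕ) : X * derivative ℝ (geomProd k) = geomProd k *
    ∑ j ∈ Finset.range k, ((j + 2 : ℕ) : ℝ) • (X ^ (j + 2) * geomSeries (j + 2)) := by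
  induction k with
  | zero => simp [geomProd]
  | succ k ih =>
    rw [Finset.sum_range_succ, geomProd, Finset.prod_range_succ]
    exact X_mul_derivative_mul ih (X_mul_derivative_geomSeries (by omega))

theorem scaledSum_X_pow_mul_geomSeries_le (w N : ℕ) :
    scaledSum (X ^ (w + 1) * geomSeries (w + 1)) N ≤ 1 / (2 ^ (w + 1) - 1) := by
  have h0 : ∀ n, 0 ≤ coeff n (1 : PowerSeries ℝ) := fun n => by
    rw [coeff_one]; split_ifs <;> norm_num
  have h1 := scaledSum_geomSeries_mul_le h0 scaledSum_one_le w N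
  rw [mul_one, one_mul] at h1
  refine (scaledSum_X_pow_mul_le (coeff_geomSeries_nonneg (w + 1)) (w + 1) N).trans ?_
  have h4 := one_lt_two_pow_succ w
  rw [div_le_iff₀ (by positivity), div_mul_eq_mul_div, one_mul]
  exact h1

/-- From `X F' = F Q`, the coefficient of `F` times `n` is a convolution of `F` with `Q`. The scaled
sum of `Q` is at most `∑_{l≥2} l/(2^l - 1) + (d + 1) ≤ d + 3`. This gives decay like `1/n`. -/
theorem coeff_mul_nat_le (d k n : ℕ) {K : ℝ} (hK0 : 0 ≤ K)
    (hK : ∀ n, coeff n (geomProd k * geomSeries 1 ^ (d + 1)) / 2 ^ n ≤ K) :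
    n * (coeff n (geomProd k * geomSeries 1 ^ (d + 1)) / 2 ^ n) ≤ K * (d + 3) := by
  set F := geomProd k * geomSeries 1 ^ (d + 1)
  set Q := ∑ j ∈ Finset.range k, ((j + 2 : ℕ) : ℝ) • (X ^ (j + 2) * geomSeries (j + 2)) +
    ((d + 1 : ℕ) : ℝ) • (((1 : ℕ) : ℝ) • (X ^ 1 * geomSeries 1))
  have hF : X * derivative ℝ F = F * Q := X_mul_derivative_mul (X_mul_derivative_geomProd k)
    (X_mul_derivative_pow (X_mul_derivative_geomSeries le_rfl) (d + 1))
  have hcoeff : n * coeff n F = coeff n (F * Q) := by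
    rw [← hF]
    rcases n with _ | n
    · simp
    · rw [coeff_succ_X_mul, coeff_derivative]
      push_cast
      ring
  have hXg : ∀ w n, 0 ≤ coeff n (X ^ w * geomSeries w) := fun w n => by
    rw [coeff_X_pow_mul']
    split_ifs
    exacts [coeff_geomSeries_nonneg _ _, le_rfl]
  have hQ : ∀ n, 0 ≤ coeff n Q := fun n => by
    simp only [Q, map_add, map_sum, coeff_smul, smul_eq_mul]
    refine add_nonneg (Finset.sum_nonneg fun j _ => ?_) ?_
    · exact mul_nonneg (Nat.cast_nonneg _) (hXg _ _)
    · exact mul_nonneg (Nat.cast_nonneg _) (mul_nonneg (Nat.cast_nonneg _) (hXg _ _))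
  have hsum : scaledSum Q (n + 1) ≤ d + 3 := by
    rw [scaledSum_add, scaledSum_sum, scaledSum_smul, scaledSum_smul]
    have h1 : ∑ j ∈ Finset.range k,
        scaledSum (((j + 2 : ℕ) : ℝ) • (X ^ (j + 2) * geomSeries (j + 2))) (n + 1) ≤ 2 := by
      refine le_trans (Finset.sum_le_sum fun j _ => ?_) (sum_div_two_pow_sub_one_le k)
      rw [scaledSum_smul]
      refine (mul_le_mul_of_nonneg_left (scaledSum_X_pow_mul_geomSeries_le (j + 1) (n + 1))
        (Nat.cast_nonneg _)).trans (le_of_eq ?_)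
      push_cast
      ring
    have h2 := scaledSum_X_pow_mul_geomSeries_le 0 (n + 1)
    norm_num at h2
    have h3 : (((d + 1 : ℕ) : ℝ)) * (((1 : ℕ) : ℝ) * scaledSum (X ^ 1 * geomSeries 1) (n + 1)) ≤
        d + 1 := by
      push_cast
      rw [one_mul, pow_one]
      exact mul_le_of_le_one_right (by positivity) h2
    linarith
  rw [← mul_div_assoc, hcoeff, mul_comm F Q]
  exact (coeff_mul_div_le hQ hK n).trans (mul_le_mul_of_nonneg_left hsum hK0)

/-- The condition on `θ` is what turns the bound in terms of `2d + 1/2` from Wallis into one in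
terms of the rank `k + d`. Four ranges of `k - d` are treated: at most `0`, up to `2`, up to `4`,
and beyond. -/
theorem exists_coeff_le (d k : ℕ) (hd : 1 ≤ d) : ∃ θ : ℝ, 0 ≤ θ ∧
    θ ^ 2 * (k + d) ≤ 2 * d + 1 / 2 ∧
    coeff (k + 1) (geomProd k * geomSeries 1 ^ (d + 1)) / 2 ^ (k + 1) ≤
      scaledChoose d d * eulerPartial k * θ := by
  have hH : ∀ n, coeff n (geomSeries 1 ^ (d + 1)) / 2 ^ n = scaledChoose d n := fun n => by
    rw [coeff_geomSeries_one_pow, scaledChoose]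
  have hK : ∀ n, coeff n (geomSeries 1 ^ (d + 1)) / 2 ^ n ≤ scaledChoose d d := fun n => by
    rw [hH]; exact scaledChoose_le_self d n
  have hK0 := scaledChoose_nonneg d d
  have he1 := one_le_eulerPartial k
  have he2 := eulerPartial_le_two k
  have hbound : ∀ n, coeff n (geomProd k * geomSeries 1 ^ (d + 1)) / 2 ^ n ≤
      scaledChoose d d * eulerPartial k := fun n =>
    (coeff_mul_div_le (coeff_geomProd_nonneg k) hK n).trans
      (mul_le_mul_of_nonneg_left (scaledSum_geomProd_le k _) hK0)
  -- With `P = eulerPartial k`, the bound `ρ + (P - 1)` is at most `P (1 + ρ)/2` exactly because `P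
  -- ≤ 2` and `ρ ≤ 1`.
  have hsplit : ∀ ρ : ℝ, ρ ≤ 1 → scaledChoose d (k + 1) ≤ scaledChoose d d * ρ →
      coeff (k + 1) (geomProd k * geomSeries 1 ^ (d + 1)) / 2 ^ (k + 1) ≤
      scaledChoose d d * eulerPartial k * ((1 + ρ) / 2) := by
    intro ρ hρ h
    have h1 := coeff_mul_div_le_add (coeff_geomProd_nonneg k) (coeff_zero_geomProd k) hK (k + 1)
    rw [hH] at h1
    have h2 := mul_le_mul_of_nonneg_left
      (sub_le_sub_right (scaledSum_geomProd_le k (k + 1 + 1)) 1) hK0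
    have h3 : ρ + (eulerPartial k - 1) ≤ eulerPartial k * ((1 + ρ) / 2) := by nlinarith
    calc _ ≤ scaledChoose d d * ρ + scaledChoose d d * (eulerPartial k - 1) := by linarith
      _ = scaledChoose d d * (ρ + (eulerPartial k - 1)) := by ring
      _ ≤ scaledChoose d d * (eulerPartial k * ((1 + ρ) / 2)) :=
        mul_le_mul_of_nonneg_left h3 hK0
      _ = _ := by ring
  have hd' : (1 : ℝ) ≤ d := by exact_mod_cast hd
  rcases Nat.lt_or_ge d k with hdk | hdk
  swap
  · have hkd : (k : ℝ) ≤ d := by exact_mod_cast hdk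
    exact ⟨1, zero_le_one, by linarith, by rw [mul_one]; exact hbound _⟩
  rcases Nat.lt_or_ge (d + 2) k with hk2 | hk2
  swap
  · have hkd : (k : ℝ) ≤ d + 2 := by exact_mod_cast hk2
    refine ⟨(1 + (2 * d + 1) / (2 * (d + 2))) / 2, by positivity, ?_,
      hsplit _ ?_ (scaledChoose_add_two_le (by omega))⟩
    · have : (1 + (2 * (d : ℝ) + 1) / (2 * (d + 2))) / 2 = (4 * d + 5) / (4 * (d + 2)) := by
        field_simp; ring
      rw [this, div_pow, div_mul_eq_mul_div, div_le_iff₀ (by positivity)]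
      nlinarith [mul_le_mul_of_nonneg_left hkd (sq_nonneg (4 * (d : ℝ) + 5)),
        mul_nonneg (sub_nonneg.2 hd') (sub_nonneg.2 hd')]
    · rw [div_le_one (by positivity)]; linarith
  rcases Nat.lt_or_ge (d + 4) k with hk4 | hk4
  swap
  · have hkd : (k : ℝ) ≤ d + 4 := by exact_mod_cast hk4
    refine ⟨(1 + (2 * d + 1) * (2 * d + 3) / (4 * (d + 3) * (d + 4))) / 2, by positivity, ?_,
      hsplit _ ?_ (scaledChoose_add_four_le (by omega))⟩
    · have : (1 + (2 * (d : ℝ) + 1) * (2 * d + 3) / (4 * (d + 3) * (d + 4))) / 2 =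
          (8 * d ^ 2 + 36 * d + 51) / (8 * (d + 3) * (d + 4)) := by
        field_simp; ring
      rw [this, div_pow, div_mul_eq_mul_div, div_le_iff₀ (by positivity)]
      have h1 := mul_le_mul_of_nonneg_left hkd (sq_nonneg (8 * (d : ℝ) ^ 2 + 36 * d + 51))
      -- After the substitution `d = 1 + e` the difference of the two sides has only nonnegative
      -- coefficients.
      obtain ⟨e, he⟩ : ∃ e : ℝ, (d : ℝ) = 1 + e := ⟨d - 1, by ring⟩
      have he0 : 0 ≤ e := by linarith
      have h2 : (8 * (d : ℝ) ^ 2 + 36 * d + 51) ^ 2 * (2 * d + 4) ≤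
          (2 * d + 1 / 2) * (8 * (d + 3) * (d + 4)) ^ 2 := by
        rw [he, ← sub_nonneg]
        ring_nf
        positivity
      linarith
    · rw [div_le_one (by positivity)]; nlinarith
  · obtain ⟨t, rfl⟩ : ∃ t, k = d + 5 + t := ⟨k - (d + 5), by omega⟩
    -- The denominator is the degree `k + 1`; the quotient is the saving given by the logarithmic
    -- derivative.
    refine ⟨(d + 3) / (d + 6 + t), by positivity, ?_, ?_⟩
    · rw [div_pow, div_mul_eq_mul_div, div_le_iff₀ (by positivity)]
      obtain ⟨e, he⟩ : ∃ e : ℝ, (d : ℝ) = 1 + e := ⟨d - 1, by ring⟩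
      have he0 : 0 ≤ e := by linarith
      have ht : (0 : ℝ) ≤ t := Nat.cast_nonneg t
      push_cast
      rw [he, ← sub_nonneg]
      ring_nf
      positivity
    · have h := coeff_mul_nat_le d (d + 5 + t) (d + 5 + t + 1)
        (mul_nonneg hK0 (zero_le_one.trans he1)) hbound
      rw [← mul_div_assoc, le_div_iff₀ (by positivity)]
      refine le_trans (le_of_eq ?_) h
      push_cast
      ring

end PowerSeries

/-! ### Counting exponents of bounded weight -/

section WeightCount

open PowerSeries

theorem card_weight_le_coeff {r : ℕ} (c : ℕ) (w : Fin r → ℕ) (hw : ∀ i, 1 ≤ w i) :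
    (Nat.card {α : Fin r → ℕ // ∑ i, α i * w i ≤ c} : ℝ) ≤
      coeff c (geomSeries 1 * ∏ i, geomSeries (w i)) := by
  classical
  -- The extra index, of weight `1`, absorbs the slack `c - ∑ α_i w_i` and turns the inequality into
  -- an equation.
  let v : Option (Fin r) → ℕ := fun o => o.elim 1 w
  let P := (Finset.univ.finsuppAntidiag c).filter fun l : Option (Fin r) →₀ ℕ =>
    ∀ o ∈ Finset.univ, v o ∣ l o
  have hcoeff : coeff c (geomSeries 1 * ∏ i, geomSeries (w i)) = (P.card : ℝ) := by
    rw [show geomSeries 1 * ∏ i, geomSeries (w i) = ∏ o, geomSeries (v o) by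
      rw [Fintype.prod_option]; rfl, coeff_prod, Finset.card_filter, Nat.cast_sum]
    refine Finset.sum_congr rfl fun l _ => ?_
    simp only [geomSeries, coeff_mk, Finset.prod_ite_zero, Finset.prod_const_one, Nat.cast_ite,
      Nat.cast_one, Nat.cast_zero]
  rw [hcoeff, ← Nat.card_eq_finsetCard P, Nat.cast_le]
  let f (α : Fin r → ℕ) : Option (Fin r) →₀ ℕ := Finsupp.equivFunOnFinite.symm
    fun o => o.elim (c - ∑ i, α i * w i) fun i => α i * w i
  have hf : ∀ α : {α : Fin r → ℕ // ∑ i, α i * w i ≤ c}, f α ∈ P := fun α => by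
    rw [Finset.mem_filter, Finset.mem_finsuppAntidiag]
    refine ⟨⟨?_, Finset.subset_univ _⟩, ?_⟩
    · rw [Fintype.sum_option]
      exact Nat.sub_add_cancel α.2
    · rintro (_ | i) -
      exacts [one_dvd _, dvd_mul_left _ _]
  refine Nat.card_le_card_of_injective (fun α => (⟨f α, hf α⟩ : P)) fun α β h => ?_
  ext i
  exact Nat.eq_of_mul_eq_mul_right (hw i)
    (DFunLike.congr_fun (congrArg Subtype.val h) (some i))

/-- Choose one index for each weight `1, …, k + 1`. The remaining `d - 1` weights are replaced by
`1`; with the chosen weight `1` and the slack factor this makes the exponent `d + 1`. -/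
theorem coeff_prod_geomSeries_le {r k d : ℕ} (w : Fin r → ℕ) (hr : k + d = r)
    (hsurj : ∀ m, 1 ≤ m → m ≤ k + 1 → ∃ i, w i = m) (n : ℕ) :
    coeff n (geomSeries 1 * ∏ i, geomSeries (w i)) ≤
      coeff n (geomProd k * geomSeries 1 ^ (d + 1)) := by
  classical
  have : Nonempty (Fin r) := ⟨(hsurj 1 le_rfl (by omega)).choose⟩
  choose! σ hσ using fun j (hj : j < k + 1) => hsurj (j + 1) (by omega) hj
  have hinj : Set.InjOn σ (Finset.range (k + 1)) := fun a ha b hb hab => by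
    have ha' := hσ a (Finset.mem_range.1 ha)
    have hb' := hσ b (Finset.mem_range.1 hb)
    rw [hab] at ha'
    omega
  set T := (Finset.range (k + 1)).image σ
  have hT : ∏ i ∈ T, geomSeries (w i) = geomProd k * geomSeries 1 := by
    rw [Finset.prod_image hinj, geomProd, ← Finset.prod_range_succ' fun j => geomSeries (j + 1)]
    exact Finset.prod_congr rfl fun j hj => by rw [hσ j (Finset.mem_range.1 hj)]
  have hcard : Tᶜ.card + 1 = d := by
    have h := Finset.card_compl_add_card T
    rw [Finset.card_image_of_injOn hinj, Finset.card_range, Fintype.card_fin] at h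
    omega
  have h0 := coeff_geomSeries_nonneg
  rw [← Finset.prod_mul_prod_compl T, hT,
    show geomProd k * geomSeries 1 ^ (d + 1) =
      geomSeries 1 * (geomProd k * geomSeries 1 * ∏ _i ∈ Tᶜ, geomSeries 1) by
      rw [Finset.prod_const, ← hcard]; ring]
  have hk := coeff_mul_nonneg (coeff_geomProd_nonneg k) (h0 1)
  have hc := coeff_prod_nonneg Tᶜ fun i => h0 (w i)
  exact coeff_mul_le_mul (h0 1) (fun _ => le_rfl) (coeff_mul_nonneg hk hc)
    (coeff_mul_le_mul hk (fun _ => le_rfl) hc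
      (coeff_prod_le_prod _ (fun i => h0 (w i)) fun i => coeff_geomSeries_le (w i))) n

/-- A family of `r ≥ 1` weights between `1` and `c` all whose values are attained admits at most
`η 2^r / √r` exponents of total weight at most `c`. -/
theorem card_weight_le {r c : ℕ} (w : Fin r → ℕ) (hr : 1 ≤ r) (hc : 1 ≤ c) (hw : ∀ i, 1 ≤ w i)
    (hsurj : ∀ m, 1 ≤ m → m ≤ c → ∃ i, w i = m) :
    (Nat.card {α : Fin r → ℕ // ∑ i, α i * w i ≤ c} : ℝ) ≤ eta * (2 ^ r / Real.sqrt r) := by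
  obtain ⟨k, rfl⟩ : ∃ k, c = k + 1 := ⟨c - 1, by omega⟩
  have hkr : k + 1 ≤ r := by
    have : Nonempty (Fin r) := ⟨⟨0, hr⟩⟩
    choose! σ hσ using fun j (hj : j < k + 1) => hsurj (j + 1) (by omega) hj
    have h := Fintype.card_le_of_injective (fun j : Fin (k + 1) => σ j) fun a b hab => by
      have ha := hσ a a.2
      have hb := hσ b b.2
      simp only at hab
      rw [hab] at ha
      exact Fin.ext (by omega)
    simpa using h
  obtain ⟨d, rfl⟩ : ∃ d, r = k + d := ⟨r - k, by omega⟩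
  obtain ⟨θ, hθ0, hθ, hθ'⟩ := exists_coeff_le d k (by omega)
  rw [div_le_iff₀ (by positivity), scaledChoose_self] at hθ'
  refine ((card_weight_le_coeff (k + 1) w hw).trans
    (coeff_prod_geomSeries_le w rfl hsurj (k + 1))).trans (hθ'.trans ?_)
  have hr0 : (0 : ℝ) < (k + d : ℕ) := by exact_mod_cast hr
  have hs : 0 < Real.sqrt (k + d : ℕ) := Real.sqrt_pos.2 hr0
  have hcr := centralRatio_pos d
  have hmain : centralRatio d * θ ≤ Real.sqrt (2 / Real.pi) / Real.sqrt (k + d : ℕ) := by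
    rw [← Real.sqrt_div' _ hr0.le]
    refine Real.le_sqrt_of_sq_le ?_
    rw [le_div_iff₀ hr0]
    push_cast
    calc (centralRatio d * θ) ^ 2 * (k + d) = centralRatio d ^ 2 * (θ ^ 2 * (k + d)) := by ring
      _ ≤ centralRatio d ^ 2 * (2 * d + 1 / 2) :=
        mul_le_mul_of_nonneg_left hθ (sq_nonneg _)
      _ = 2 * (centralRatio d ^ 2 * (d + 1 / 4)) := by ring
      _ ≤ 2 * (1 / Real.pi) := mul_le_mul_of_nonneg_left (centralRatio_sq_le d) zero_le_two
      _ = 2 / Real.pi := by ring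
  have he := zero_le_one.trans (one_le_eulerPartial k)
  calc 2 ^ d * centralRatio d * eulerPartial k * θ * 2 ^ (k + 1)
      = 2 ^ (k + d) * (2 * eulerPartial k) * (centralRatio d * θ) := by ring
    _ ≤ 2 ^ (k + d) * (2 * eulerPartial k) *
        (Real.sqrt (2 / Real.pi) / Real.sqrt (k + d : ℕ)) :=
      mul_le_mul_of_nonneg_left hmain (by positivity)
    _ = Real.sqrt (2 / Real.pi) * (2 * eulerPartial k) *
        (2 ^ (k + d) / Real.sqrt (k + d : ℕ)) := by ring
    _ ≤ eta * (2 ^ (k + d) / Real.sqrt (k + d : ℕ)) :=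
      mul_le_mul_of_nonneg_right (two_mul_eulerPartial_le_eta k) (by positivity)

end WeightCount

/-! ### The quotient `U / U^m`: rank, left multiplication, faithfulness -/

section Truncation

variable {R : Type u} [CommRing R] [IsDomain R]
variable {M : Type v} [LieRing M] [LieAlgebra R M] [LieRing.IsNilpotent M]
variable [Module.IsTorsionFree R M] {r : ℕ} {b : Module.Basis (Fin r) R M}

theorem finite_monomialWeight_le (b : Module.Basis (Fin r) R M) (m : ℕ) :
    Finite ({α | m < monomialWeight b α}ᶜ : Set (Fin r → ℕ)) := by
  refine (Set.finite_Iic (fun _ : Fin r => m)).subset fun α hα i => ?_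
  rw [Set.mem_compl_iff, Set.mem_ofPred_eq, not_lt] at hα
  calc α i ≤ α i * elementWeight R (b i) :=
      Nat.le_mul_of_pos_right _ (one_le_elementWeight (b.ne_zero i))
    _ ≤ monomialWeight b α :=
      Finset.single_le_sum (f := fun i => α i * elementWeight R (b i)) (fun _ _ => Nat.zero_le _)
        (Finset.mem_univ i)
    _ ≤ m := hα

theorem IsAdapted.free_truncation (hb : IsAdapted b) (m : ℕ) : Module.Free R (truncation b m) :=
  Module.Free.of_equiv (hb.truncationEquiv m).symm

theorem IsAdapted.finite_truncation (hb : IsAdapted b) (m : ℕ) :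
    Module.Finite R (truncation b m) := by
  have := finite_monomialWeight_le b m
  exact Module.Finite.equiv (hb.truncationEquiv m).symm

theorem IsAdapted.finrank_truncation (hb : IsAdapted b) (m : ℕ) :
    Module.finrank R (truncation b m) = Nat.card {α : Fin r → ℕ // monomialWeight b α ≤ m} := by
  have := finite_monomialWeight_le b m
  have := Fintype.ofFinite ({α | m < monomialWeight b α}ᶜ : Set (Fin r → ℕ))
  rw [(hb.truncationEquiv m).finrank_eq, Module.finrank_finsupp_self, ← Nat.card_eq_fintype_card]
  refine Nat.card_congr (Equiv.subtypeEquivRight fun α => ?_)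
  simp

theorem IsAdapted.finrank_truncation_le (hb : IsAdapted b) (hr : 1 ≤ r) :
    (Module.finrank R (truncation b (nilpotencyClass M)) : ℝ) ≤
      eta * (2 ^ r / Real.sqrt r) := by
  rw [hb.finrank_truncation]
  refine card_weight_le _ hr ?_ (fun i => one_le_elementWeight (b.ne_zero i))
    fun m h1 h2 => hb.exists_elementWeight_eq h1 h2
  exact (one_le_elementWeight (R := R) (b.ne_zero ⟨0, hr⟩)).trans (elementWeight_le (b.ne_zero _))

theorem IsAdapted.ι_mul_mem (hb : IsAdapted b) (m : ℕ) (x : M)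
    {u : UniversalEnvelopingAlgebra R M} (hu : u ∈ weightSubmodule b m) :
    UniversalEnvelopingAlgebra.ι R x * u ∈ weightSubmodule b m := by
  rw [weightSubmodule_eq_weightFiltration] at hu ⊢
  have hx : x ∈ Submodule.span R (b '' {i | 0 ≤ elementWeight R (b i)}) := by simp
  have h := ι_mul_mem_weightFiltration b _ hb.lie_mem_span hx hu
  rwa [zero_add] at h

theorem IsAdapted.derivation_mem (hb : IsAdapted b) (m : ℕ) {D : M →ₗ[R] M}
    (hD : ∀ x y, D ⁅x, y⁆ = ⁅D x, y⁆ + ⁅x, D y⁆)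
    {E : UniversalEnvelopingAlgebra R M →ₗ[R] UniversalEnvelopingAlgebra R M}
    (hE : IsDerivationExtension D E) {u : UniversalEnvelopingAlgebra R M}
    (hu : u ∈ weightSubmodule b m) : E u ∈ weightSubmodule b m := by
  rw [weightSubmodule_eq_weightFiltration] at hu ⊢
  exact derivation_mem_weightFiltration b _ hb.lie_mem_span (hb.derivation_mem_span hD) hE hu

/-- The left multiplication by `x` on `U / U^m`. -/
def IsAdapted.leftMul (hb : IsAdapted b) (m : ℕ) (x : M) : Module.End R (truncation b m) :=
  (weightSubmodule b m).mapQ (weightSubmodule b m)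
    (LinearMap.mulLeft R (UniversalEnvelopingAlgebra.ι R x)) fun _ hu => hb.ι_mul_mem m x hu

theorem IsAdapted.leftMul_mk (hb : IsAdapted b) (m : ℕ) (x : M)
    (u : UniversalEnvelopingAlgebra R M) :
    hb.leftMul m x (Submodule.Quotient.mk u) =
      Submodule.Quotient.mk (UniversalEnvelopingAlgebra.ι R x * u) :=
  rfl

/-- An element of `M` that lies in `U^m` with `m` at least the nilpotency class vanishes. -/
theorem IsAdapted.eq_zero_of_ι_mem (hb : IsAdapted b) {x : M}
    (hx : UniversalEnvelopingAlgebra.ι R x ∈ weightSubmodule b (nilpotencyClass M)) : x = 0 := by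
  rw [hb.weightSubmodule_eq_span, Module.Basis.mem_span_image] at hx
  set B := monomialBasis b (fun i => elementWeight R (b i)) hb.lie_mem_span hb.lie_mem_span_lt
  have hB : ∀ i, UniversalEnvelopingAlgebra.ι R (b i) = B (Pi.single i 1) := by
    intro i
    have h1 : B (Pi.single i 1) = monomial b (Pi.single i 1) := by
      simp only [B, monomialBasis, Module.Basis.mk_apply]
    rw [h1, ← wordProd_orderedWord]
    have h2 : (fun j => List.count j [i]) = Pi.single i 1 := by
      ext j
      by_cases h : j = i
      · subst h; simp
      · simp [h, Ne.symm h]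
    have h3 := perm_orderedWord [i]
    rw [h2] at h3
    rw [List.perm_singleton.1 h3.symm]
    simp [wordProd, -UniversalEnvelopingAlgebra.ι_apply]
  -- The linear coordinates of the image of `x` in the monomial basis are the coordinates of `x`.
  have hrepr : ∀ i, b.repr x i = B.repr (UniversalEnvelopingAlgebra.ι R x) (Pi.single i 1) := by
    intro i
    conv_rhs => rw [← b.sum_repr x]
    rw [map_sum, map_sum, Finsupp.finsetSum_apply, Finset.sum_eq_single i]
    · rw [map_smul, map_smul, hB, B.repr_self]
      simp
    · intro j _ hj
      rw [map_smul, map_smul, hB, B.repr_self, Finsupp.smul_apply, Finsupp.single_eq_of_ne, smul_zero]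
      intro h
      have := congrFun h j
      rw [Pi.single_eq_same, Pi.single_eq_of_ne hj] at this
      exact zero_ne_one this
    · simp
  refine b.ext_elem fun i => ?_
  rw [map_zero, Finsupp.zero_apply, hrepr]
  by_contra h
  have h1 : nilpotencyClass M < monomialWeight b (Pi.single i 1) :=
    hx (Finsupp.mem_support_iff.2 h)
  have h2 : monomialWeight b (Pi.single i 1) = elementWeight R (b i) := by
    rw [monomialWeight, Finset.sum_eq_single i]
    · simp
    · intro j _ hj
      simp [Pi.single_eq_of_ne hj]
    · simp
  rw [h2] at h1
  exact absurd h1 (not_lt.2 (elementWeight_le (b.ne_zero i)))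

end Truncation

/-! ### The representation of `N ⋊ S` -/

section Representation

variable {R : Type u} [CommRing R] [IsDomain R] {L : Type v} [LieRing L] [LieAlgebra R L]

theorem toEnd_isDerivation (N : LieIdeal R L) (s : L) (x y : N) :
    LieModule.toEnd R L N s ⁅x, y⁆ =
      ⁅LieModule.toEnd R L N s x, y⁆ + ⁅x, LieModule.toEnd R L N s y⁆ := by
  ext
  simp

/-- The derivation of `U(N)` that extends `ad s`. -/
def radicalDerivation (N : LieIdeal R L) :
    L →ₗ[R] Module.End R (UniversalEnvelopingAlgebra R N) where
  toFun s := idealDerivation N s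
  map_add' s t := derivation_enveloping_ext (derivationExtension_mul _ _)
    (fun u v => by
      simp only [LinearMap.add_apply, idealDerivation, derivationExtension_mul, add_mul, mul_add]
      abel)
    (fun x => by
      simp only [LinearMap.add_apply, idealDerivation, derivationExtension_ι, map_add])
  map_smul' a s := derivation_enveloping_ext (derivationExtension_mul _ _)
    (fun u v => by
      simp only [LinearMap.smul_apply, idealDerivation, derivationExtension_mul, smul_add,
        smul_mul_assoc, mul_smul_comm, RingHom.id_apply])
    (fun x => by
      simp only [LinearMap.smul_apply, idealDerivation, derivationExtension_ι, map_smul,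
        RingHom.id_apply])

theorem isDerivationExtension_radicalDerivation (N : LieIdeal R L) (s : L) :
    IsDerivationExtension (LieModule.toEnd R L N s) (radicalDerivation N s) :=
  ⟨derivationExtension_mul _ _, derivationExtension_ι _ _⟩

/-- A commutator of derivations is a derivation, so both sides need to be compared on `N` only,
where this is the module axiom for `ad`. -/
theorem radicalDerivation_lie (N : LieIdeal R L) (s t : L) :
    radicalDerivation N ⁅s, t⁆ = radicalDerivation N s * radicalDerivation N t -
      radicalDerivation N t * radicalDerivation N s := by
  have hmul := fun s => (isDerivationExtension_radicalDerivation N s).1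
  have hι := fun s => (isDerivationExtension_radicalDerivation N s).2
  refine derivation_enveloping_ext (hmul _) (fun u v => ?_) (fun x => ?_)
  · simp only [LinearMap.sub_apply, Module.End.mul_apply, hmul, map_add, sub_mul, mul_sub]
    abel
  · simp only [LinearMap.sub_apply, Module.End.mul_apply, hι, LieHom.map_lie, ← map_sub]
    congr 1

variable {N : LieIdeal R L} [LieRing.IsNilpotent N] [Module.IsTorsionFree R N] {r : ℕ}
  {b : Module.Basis (Fin r) R N}

/-- The endomorphism of `U / U^m` induced by the derivation that extends `ad s`. -/
def IsAdapted.inducedDerivation (hb : IsAdapted b) (m : ℕ) (s : L) :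
    Module.End R (truncation b m) :=
  (weightSubmodule b m).mapQ (weightSubmodule b m) (radicalDerivation N s) fun _ hu =>
    hb.derivation_mem m (toEnd_isDerivation N s) (isDerivationExtension_radicalDerivation N s) hu

theorem IsAdapted.inducedDerivation_mk (hb : IsAdapted b) (m : ℕ) (s : L)
    (u : UniversalEnvelopingAlgebra R N) :
    hb.inducedDerivation m s (Submodule.Quotient.mk u) =
      Submodule.Quotient.mk (radicalDerivation N s u) :=
  rfl

theorem truncation_end_ext {m : ℕ} {f g : Module.End R (truncation b m)}
    (h : ∀ u : UniversalEnvelopingAlgebra R N,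
      f (Submodule.Quotient.mk u) = g (Submodule.Quotient.mk u)) : f = g := by
  ext u
  exact h u

/-- The projection of `L = N ⊕ S` to the ideal `N`. -/
def idealProjection (S : LieSubalgebra R L) (hS : IsCompl N.toSubmodule S.toSubmodule) :
    L →ₗ[R] N :=
  N.toSubmodule.projectionOnto S.toSubmodule hS

/-- The representation of `L = N ⋊ S` on `U / U^m`: `N` acts by left multiplication, `S` by
derivations. -/
def IsAdapted.representation (hb : IsAdapted b) (m : ℕ) (S : LieSubalgebra R L)
    (hS : IsCompl N.toSubmodule S.toSubmodule) :
    L →ₗ⁅R⁆ Module.End R (truncation b m) :=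
  let p : L →ₗ[R] N := idealProjection S hS
  let q : L →ₗ[R] L := S.toSubmodule.projection N.toSubmodule hS.symm
  { toFun := fun x => hb.leftMul m (p x) + hb.inducedDerivation m (q x)
    map_add' := fun x y => truncation_end_ext fun u => by
      simp only [LinearMap.add_apply, hb.leftMul_mk, hb.inducedDerivation_mk, map_add, add_mul,
        Submodule.Quotient.mk_add]
      abel
    map_smul' := fun a x => truncation_end_ext fun u => by
      simp only [LinearMap.add_apply, LinearMap.smul_apply, hb.leftMul_mk,
        hb.inducedDerivation_mk, map_smul, smul_mul_assoc, Submodule.Quotient.mk_smul,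
        RingHom.id_apply, smul_add]
    map_lie' := fun {x y} => truncation_end_ext fun u => by
      have hpq : ∀ z : L, (p z : L) + q z = z := fun z =>
        Submodule.projection_add_projection_eq_self hS z
      have hqS : ∀ z : L, q z ∈ S := fun z => SetLike.coe_mem
        (S.toSubmodule.projectionOnto N.toSubmodule hS.symm z)
      have hS' : ⁅q x, q y⁆ ∈ S := S.lie_mem (hqS x) (hqS y)
      -- The decomposition of a bracket along `N ⊕ S`: the mixed terms fall into the ideal `N`, the
      -- last term into the subalgebra `S`.
      have h : ⁅x, y⁆ = ((⁅p x, p y⁆ + ⁅q x, p y⁆ - ⁅q y, p x⁆ : N) : L) + ⁅q x, q y⁆ := by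
        conv_lhs => rw [← hpq x, ← hpq y]
        simp only [add_lie, lie_add, LieSubmodule.coe_add, LieSubmodule.coe_sub,
          LieSubmodule.coe_bracket]
        rw [← lie_skew (q y) (p x : L)]
        change _ = ⁅(p x : L), (p y : L)⁆ + _ - _ + _
        abel
      have hp : p ⁅x, y⁆ = ⁅p x, p y⁆ + ⁅q x, p y⁆ - ⁅q y, p x⁆ := by
        rw [h, map_add]
        exact (congrArg₂ _ (Submodule.projectionOnto_apply_left hS _)
          (Submodule.projectionOnto_apply_right hS ⟨_, hS'⟩)).trans (add_zero _)
      have hq : q ⁅x, y⁆ = ⁅q x, q y⁆ := by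
        have h1 := hpq ⁅x, y⁆
        rw [hp] at h1
        conv_rhs at h1 => rw [h]
        exact add_left_cancel h1
      have hιl : UniversalEnvelopingAlgebra.ι R ⁅p x, p y⁆ =
          UniversalEnvelopingAlgebra.ι R (p x) * UniversalEnvelopingAlgebra.ι R (p y) -
            UniversalEnvelopingAlgebra.ι R (p y) * UniversalEnvelopingAlgebra.ι R (p x) :=
        LieHom.map_lie _ _ _
      change (hb.leftMul m (p ⁅x, y⁆) + hb.inducedDerivation m (q ⁅x, y⁆))
          (Submodule.Quotient.mk u) =
        (hb.leftMul m (p x) + hb.inducedDerivation m (q x))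
          ((hb.leftMul m (p y) + hb.inducedDerivation m (q y)) (Submodule.Quotient.mk u)) -
        (hb.leftMul m (p y) + hb.inducedDerivation m (q y))
          ((hb.leftMul m (p x) + hb.inducedDerivation m (q x)) (Submodule.Quotient.mk u))
      have hι : ∀ (s : L) (n : N) (u : UniversalEnvelopingAlgebra R N), radicalDerivation N s
          (UniversalEnvelopingAlgebra.ι R n * u) = UniversalEnvelopingAlgebra.ι R ⁅s, n⁆ * u +
            UniversalEnvelopingAlgebra.ι R n * radicalDerivation N s u := idealDerivation_ι_mul
      rw [hp, hq]
      simp only [LinearMap.add_apply, map_add, hb.leftMul_mk, hb.inducedDerivation_mk,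
        radicalDerivation_lie, LinearMap.sub_apply, Module.End.mul_apply, hι, map_sub,
        hιl, add_mul, sub_mul, mul_assoc,
        Submodule.Quotient.mk_add, Submodule.Quotient.mk_sub]
      abel }

theorem IsAdapted.representation_coe (hb : IsAdapted b) (m : ℕ) (S : LieSubalgebra R L)
    (hS : IsCompl N.toSubmodule S.toSubmodule) (n : N) :
    hb.representation m S hS (n : L) = hb.leftMul m n := by
  refine truncation_end_ext fun u => ?_
  change (Submodule.Quotient.mk (UniversalEnvelopingAlgebra.ι R
      (idealProjection S hS (n : L)) * u) : truncation b m) +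
    Submodule.Quotient.mk (radicalDerivation N
      (S.toSubmodule.projection N.toSubmodule hS.symm (n : L)) u) = _
  have h1 : idealProjection S hS (n : L) = n :=
    Submodule.projectionOnto_apply_left hS n
  have h2 : S.toSubmodule.projection N.toSubmodule hS.symm (n : L) = 0 :=
    congrArg Subtype.val (Submodule.projectionOnto_apply_right hS.symm n)
  rw [h1, h2, map_zero, LinearMap.zero_apply, Submodule.Quotient.mk_zero, add_zero]
  rfl

theorem IsAdapted.representation_of_mem (hb : IsAdapted b) (m : ℕ) (S : LieSubalgebra R L)
    (hS : IsCompl N.toSubmodule S.toSubmodule) {s : L} (hs : s ∈ S) :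
    hb.representation m S hS s = hb.inducedDerivation m s := by
  refine truncation_end_ext fun u => ?_
  change (Submodule.Quotient.mk (UniversalEnvelopingAlgebra.ι R
      (idealProjection S hS s) * u) : truncation b m) +
    Submodule.Quotient.mk (radicalDerivation N
      (S.toSubmodule.projection N.toSubmodule hS.symm s) u) = _
  have h1 : idealProjection S hS s = 0 :=
    Submodule.projectionOnto_apply_right hS ⟨s, hs⟩
  have h2 : S.toSubmodule.projection N.toSubmodule hS.symm s = s :=
    congrArg Subtype.val (Submodule.projectionOnto_apply_left hS.symm ⟨s, hs⟩)
  rw [h1, h2, map_zero, zero_mul, Submodule.Quotient.mk_zero, zero_add]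
  rfl

end Representation

end

end LieLattice

/-! ### The theorem -/

theorem proposition3p2 {R : Type*} [CommRing R] [IsDomain R] [IsPrincipalIdealRing R] [CharZero R]
    {L : Type*} [LieRing L] [LieAlgebra R L] [Module.Free R L] [Module.Finite R L]
    (hL : LieLattice.IsSplittable R L)
    (r : ℕ) (hr : r = Module.finrank R (LieLattice.nilpotentRadical R L))
    (c : ℕ) (hc : c = LieLattice.nilpotencyClass (LieLattice.nilpotentRadical R L)) :
    -- the nilpotent radical is nilpotent, so that its class is meaningful
    LieRing.IsNilpotent (LieLattice.nilpotentRadical R L) ∧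
    -- adapted bases exist
    (∃ b : Module.Basis (Fin r) R (LieLattice.nilpotentRadical R L), LieLattice.IsAdapted b) ∧
    ∀ b : Module.Basis (Fin r) R (LieLattice.nilpotentRadical R L), LieLattice.IsAdapted b →
      -- the representation space is free of finite rank, with the bound on the rank
      Module.Free R (LieLattice.truncation b c) ∧
      Module.Finite R (LieLattice.truncation b c) ∧
      (1 ≤ r → (Module.finrank R (LieLattice.truncation b c) : ℝ) ≤
        LieLattice.eta * (2 ^ r / Real.sqrt r)) ∧
      -- for every complement of the nilpotent radical, the representation
      ∀ S : LieSubalgebra R L, LieLattice.IsSplitting R L S →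
        ∃ Φ : L →ₗ⁅R⁆ Module.End R (LieLattice.truncation b c),
          Set.InjOn Φ (LieLattice.nilpotentRadical R L) ∧
          (∀ (n : LieLattice.nilpotentRadical R L) (u : LieLattice.radicalEnveloping R L),
            Φ (n : L) (Submodule.Quotient.mk u) =
              Submodule.Quotient.mk (UniversalEnvelopingAlgebra.ι R n * u)) ∧
          ∀ s ∈ S, ∃ E : LieLattice.radicalEnveloping R L →ₗ[R] LieLattice.radicalEnveloping R L,
            LieLattice.IsDerivationExtension
              (LieModule.toEnd R L (LieLattice.nilpotentRadical R L) s) E ∧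
            ∀ u : LieLattice.radicalEnveloping R L,
              Φ s (Submodule.Quotient.mk u) = Submodule.Quotient.mk (E u) := by
  have hnil : LieRing.IsNilpotent (LieLattice.nilpotentRadical R L) :=
    LieLattice.isNilpotent_nilpotentRadical
  subst hc
  refine ⟨hnil, LieLattice.exists_isAdapted hr, fun b hb => ⟨hb.free_truncation _,
    hb.finite_truncation _, hb.finrank_truncation_le, fun S hS => ?_⟩⟩
  replace hS : IsCompl (LieLattice.nilpotentRadical R L).toSubmodule S.toSubmodule := hS
  refine ⟨hb.representation _ S hS, fun x hx y hy h => ?_, fun n u => ?_, fun s hs =>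
    ⟨_, LieLattice.isDerivationExtension_radicalDerivation _ s, fun u => ?_⟩⟩
  · lift x to LieLattice.nilpotentRadical R L using hx
    lift y to LieLattice.nilpotentRadical R L using hy
    rw [hb.representation_coe, hb.representation_coe] at h
    -- Evaluated at the class of `1`, equal operators give elements of `N` congruent modulo `U^c`,
    -- which meets `N` trivially.
    have h1 := DFunLike.congr_fun h (Submodule.Quotient.mk 1)
    rw [hb.leftMul_mk, hb.leftMul_mk, mul_one, mul_one, Submodule.Quotient.eq, ← map_sub] at h1
    rw [sub_eq_zero.1 (hb.eq_zero_of_ι_mem h1)]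
  · rw [hb.representation_coe, hb.leftMul_mk]
  · rw [hb.representation_of_mem _ S hS hs, hb.inducedDerivation_mk]
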